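/- Let $(V,E)$ be a finite directed graph (loops and multiple edges allowed) in which every vertex has at least one outgoing edge; write $i(e)$ and $t(e)$ for the initial and terminal vertices of $e\in E$. Assume that it is strongly connected, i.e. for all $v,v'\in V$ there is a directed path of positive length from $v$ to $v'$. For each $e\in E$ let $\psi_e(\xi)=T_e\xi+t_e$ be a map of $\mathbb R^2$ with $t_e\in\mathbb R^2$ and $$T_e=\begin{pmatrix}\pm a_e&0\\0&\pm b_e\end{pmatrix}\quad\text{or}\quad T_e=\begin{pmatrix}0&\pm a_e\\ \pm b_e&0\end{pmatrix},\qquad 0<a_e,b_e<1$$ (a strongly connected planar box-like self-affine graph-directed IFS). Let $\{X_v\}_{v\in V}$ be the unique family of non-empty compact sets with $X_v=\bigcup_{e:\,i(e)=v}\psi_e(X_{t(e)})$ for all $v\in V$. Let $(p_e)_{e\in E}$ be positive numbers with $\sum_{e:\,i(e)=v}p_e=1$ for all $v\in V$, and let $\{\mu_v\}_{v\in V}$ be the associated family of Borel probability measures, $\mu_v$ supported on $X_v$, with $$\mu_v=\sum_{e:\,i(e)=v}p_e\cdot\mu_{t(e)}\circ\psi_e^{-1}\quad\text{for all }v\in V.$$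 Let $\mu_v^x,\mu_v^y$ be the projections of $\mu_v$ onto the $x$-axis and the $y$-axis. For a compactly supported Borel probability measure $\nu$ on $\mathbb R$, $q\ge 0$ and $\delta>0$ put $\mathcal D^q_\delta(\nu)=\sum_Q\nu(Q)^q$, the sum over the closed intervals $Q=[k\delta,(k+1)\delta]$, $k\in\mathbb Z$, with $\nu(Q)>0$. The $L^q$-spectrum $\tau_\nu(q)$ exists if the lower and upper limits of $\log\mathcal D^q_\delta(\nu)/(-\log\delta)$ as $\delta\to0+$ coincide and are finite, and it is then their common value. Then $\tau_{\mu_v^x}(q)$ and $\tau_{\mu_v^y}(q)$ exist for all $q\ge0$ and $v\in V$. Moreover, the family $\{\mu_v^x,\mu_v^y\}_{v\in V}$ (indexed by $V\times\{x,y\}$, so that members with different indices count as different even if they are equal as measures) can be divided into two disjoint families $A$ and $B$ with $\#A=\#B=\#V$ such that for all $q\ge 0$ there are real numbers $\tau_A(q),\tau_B(q)$ with $$\tau_\nu(q)=\tau_A(q)\ \text{ for all }\nu\in A,\qquad \tau_\nu(q)=\tau_B(q)\ \text{ for all }\nu\in B,$$ and for all $v\in V$ either $\mu_v^x\in A,\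 \mu_v^y\in B$ or $\mu_v^x\in B,\ \mu_v^y\in A$. In particular, when all $T_e$ are diagonal, one can take $A=\{\mu_v^x\}_{v\in V}$ and $B=\{\mu_v^y\}_{v\in V}$. -/

import Mathlib

open MeasureTheory Filter Topology

noncomputable section

namespace BoxLike

/-- A matrix `diag(±a, ±b)` with `0 < a, b < 1`. -/
def IsContractingDiagonal (T : Matrix (Fin 2) (Fin 2) ℝ) : Prop :=
  ∃ a b : ℝ, (0 < |a| ∧ |a| < 1) ∧ (0 < |b| ∧ |b| < 1) ∧ T = !![a, 0; 0, b]

/-- An anti-diagonal matrix with non-zero entries `±a, ±b`, where `0 < a, b < 1`. -/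
def IsContractingAntiDiagonal (T : Matrix (Fin 2) (Fin 2) ℝ) : Prop :=
  ∃ a b : ℝ, (0 < |a| ∧ |a| < 1) ∧ (0 < |b| ∧ |b| < 1) ∧ T = !![0, a; b, 0]

/-- A planar box-like self-affine graph-directed iterated function system with vertex set `V` and
edge set `E` (loops and multiple edges are allowed); the edge `e` from `src e` to `tgt e` carries
the map `ξ ↦ T e ξ + t e` of the plane. -/
structure GIFS (V E : Type*) where
  /-- initial vertex of an edge -/
  src : E → V
  /-- terminal vertex of an edge -/
  tgt : E → V
  /-- linear parts -/
  T : E → Matrix (Fin 2) (Fin 2) ℝ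
  /-- translation parts -/
  t : E → Fin 2 → ℝ
  exists_edge : ∀ v, ∃ e, src e = v
  boxLike : ∀ e, IsContractingDiagonal (T e) ∨ IsContractingAntiDiagonal (T e)

namespace GIFS

variable {V E : Type*}

/-- The map of the plane attached to an edge. -/
def ψ (G : GIFS V E) (e : E) (ξ : Fin 2 → ℝ) : Fin 2 → ℝ :=
  (G.T e).mulVec ξ + G.t e

/-- There is a directed path (of positive length) from every vertex to every vertex. -/
def StronglyConnected (G : GIFS V E) : Prop :=
  ∀ v v' : V, Relation.TransGen (fun u u' => ∃ e, G.src e = u ∧ G.tgt e = u') v v'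

/-- `X` is the graph-directed self-affine set family: the family of non-empty compact sets
with `X v = ⋃ ψ_e (X (t(e)))`, the union over the edges `e` leaving `v`. -/
def IsAttractor (G : GIFS V E) (X : V → Set (Fin 2 → ℝ)) : Prop :=
  ∀ v, (X v).Nonempty ∧ IsCompact (X v) ∧
    X v = ⋃ (e : E) (_ : G.src e = v), G.ψ e '' X (G.tgt e)

variable [DecidableEq V] [Fintype E]

/-- A positive vector whose entries over the edges leaving any given vertex add up to one. -/
def IsPositiveVector (G : GIFS V E) (p : E → ℝ) : Prop :=
  (∀ e, 0 < p e) ∧ ∀ v, ∑ e with G.src e = v, p e = 1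

/-- `μ` is the graph-directed self-affine measure family of the system and the vector `p`:
Borel probability measures supported on the self-affine set family with
`μ v = ∑ p_e μ_{t(e)} ∘ ψ_e⁻¹`, the sum over the edges `e` leaving `v`. -/
structure IsMeasureFamily (G : GIFS V E) (p : E → ℝ) (μ : V → Measure (Fin 2 → ℝ)) : Prop where
  isProbability : ∀ v, IsProbabilityMeasure (μ v)
  supported : ∃ X : V → Set (Fin 2 → ℝ), G.IsAttractor X ∧ ∀ v, μ v (X v)ᶜ = 0
  selfAffine : ∀ v, μ v =
    ∑ e with G.src e = v, ENNReal.ofReal (p e) • (μ (G.tgt e)).map (G.ψ e)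

end GIFS

/-- Projection of a planar measure onto a coordinate axis: `i = 0` is the `x`-axis and `i = 1` is
the `y`-axis. -/
def proj (μ : Measure (Fin 2 → ℝ)) (i : Fin 2) : Measure ℝ :=
  μ.map (fun ξ => ξ i)

open Classical in
/-- The sum of `ν(Q)^q` over the closed intervals `Q` of the `δ`-mesh of the line. Intervals of
measure zero contribute nothing, also for `q = 0`. -/
def meshSum (ν : Measure ℝ) (q δ : ℝ) : ℝ :=
  ∑' k : ℤ, if ν (Set.Icc (k * δ) ((k + 1) * δ)) = 0 then 0
    else (ν.real (Set.Icc (k * δ) ((k + 1) * δ))) ^ q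

/-- The upper `L^q`-spectrum. -/
def upperLq (ν : Measure ℝ) (q : ℝ) : EReal :=
  limsup (fun δ : ℝ => ((Real.log (meshSum ν q δ) / (-Real.log δ) : ℝ) : EReal)) (𝓝[>] 0)

/-- The lower `L^q`-spectrum. -/
def lowerLq (ν : Measure ℝ) (q : ℝ) : EReal :=
  liminf (fun δ : ℝ => ((Real.log (meshSum ν q δ) / (-Real.log δ) : ℝ) : EReal)) (𝓝[>] 0)

/-- The `L^q`-spectrum of `ν` at `q` exists and is the real number `τ`. -/
def HasLqSpectrum (ν : Measure ℝ) (q τ : ℝ) : Prop :=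
  lowerLq ν q = τ ∧ upperLq ν q = τ

/-- `A` and `B` divide the family of all projections of the `μ v` into two families of `#V`
members each, every one with a common `L^q`-spectrum for each `q ≥ 0`, such that the two
projections of each `μ v` lie in different families. The member `(v, i)` stands for
`proj (μ v) i`: families are indexed, since distinct members may be equal as measures. -/
def IsSpectralSplitting {V : Type*} (μ : V → Measure (Fin 2 → ℝ)) (A B : Set (V × Fin 2)) :
    Prop :=
  A ∪ B = Set.univ ∧ Disjoint A B ∧ A.ncard = Nat.card V ∧ B.ncard = Nat.card V ∧
  (∀ q : ℝ, 0 ≤ q → ∃ τA τB : ℝ,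
    (∀ m ∈ A, HasLqSpectrum (proj (μ m.1) m.2) q τA) ∧
    (∀ m ∈ B, HasLqSpectrum (proj (μ m.1) m.2) q τB)) ∧
  ∀ v, ((v, 0) ∈ A ∧ (v, 1) ∈ B) ∨ ((v, 0) ∈ B ∧ (v, 1) ∈ A)

end BoxLike

end

/-!
Let `i ∈ {x, y}` be a coordinate axis. The projection of `μ_{t(e)} ∘ ψ_e⁻¹` to the axis `i` is a
similar copy of a projection of `μ_{t(e)}`, to the same axis if `T_e` is diagonal and to the other
axis if `T_e` is anti-diagonal. So the `2 #V` projections form a family of self-similar measures on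
the line, directed by a double cover of the graph.

Let `M(r) = r⁻¹ ∫ ν(B(x, r))^q dx`, which is comparable to the mesh sum of `ν` at scale `r`. At
scale `δ` each measure of the family is a mixture of similar copies, of ratio about `δ`, of measures
reachable from it. By convexity of `x ↦ x^q` for `q ≥ 1`, and concavity for `q ≤ 1`, the function
`M` is almost submultiplicative, respectively almost supermultiplicative, without any separation
condition. Fekete's lemma then gives the limit of `log M(r) / (-log r)`. Measures reachable from
each other have comparable `M`, hence the same spectrum. Since the graph is strongly connected,
the double cover has at most two components and exchanging the axes permutes them; a section of
the cover whose values are reachable from each other divides the family.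
-/

noncomputable section

namespace BoxLike

open scoped ENNReal NNReal
open Metric (closedBall)

/-! ### Powers with `0 ^ 0 = 0` -/

open Classical in
/-- The power `x ^ q` with the convention `0 ^ q = 0` for every `q`, which lets moment sums of
exponent `0` count the sets of positive measure. -/
def posPow (q : ℝ) (x : ℝ≥0∞) : ℝ≥0∞ := if x = 0 then 0 else x ^ q

@[simp]
theorem posPow_zero (q : ℝ) : posPow q 0 = 0 := by simp [posPow]

theorem posPow_of_ne_zero (q : ℝ) {x : ℝ≥0∞} (hx : x ≠ 0) : posPow q x = x ^ q := by
  simp [posPow, hx]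

theorem posPow_eq_rpow {q : ℝ} (hq : 0 < q) (x : ℝ≥0∞) : posPow q x = x ^ q := by
  rcases eq_or_ne x 0 with rfl | hx
  · simp [hq]
  · exact posPow_of_ne_zero q hx

theorem posPow_eq_zero {q : ℝ} (hq : 0 ≤ q) {x : ℝ≥0∞} : posPow q x = 0 ↔ x = 0 := by
  refine ⟨fun h => ?_, fun h => h ▸ posPow_zero q⟩
  by_contra hx
  rw [posPow_of_ne_zero q hx, ENNReal.rpow_eq_zero_iff] at h
  exact h.elim (fun h => hx h.1) fun h => hq.not_gt h.2

theorem posPow_mono {q : ℝ} (hq : 0 ≤ q) : Monotone (posPow q) := by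
  intro x y hxy
  rcases eq_or_ne x 0 with rfl | hx
  · simp
  rw [posPow_of_ne_zero q hx, posPow_of_ne_zero q (ne_bot_of_le_ne_bot hx hxy)]
  exact ENNReal.rpow_le_rpow hxy hq

@[fun_prop]
theorem measurable_posPow (q : ℝ) : Measurable (posPow q) :=
  Measurable.ite (measurableSet_singleton 0) measurable_const (by fun_prop)

theorem posPow_ne_top {q : ℝ} (hq : 0 ≤ q) {x : ℝ≥0∞} (hx : x ≠ ∞) : posPow q x ≠ ∞ := by
  unfold posPow
  split_ifs
  exacts [ENNReal.zero_ne_top, ENNReal.rpow_ne_top_of_nonneg hq hx]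

theorem posPow_mul {q : ℝ} (hq : 0 ≤ q) {c : ℝ≥0∞} (hc : c ≠ 0) (x : ℝ≥0∞) :
    posPow q (c * x) = c ^ q * posPow q x := by
  rcases eq_or_ne x 0 with rfl | hx
  · simp
  rw [posPow_of_ne_zero q hx, posPow_of_ne_zero q (mul_ne_zero hc hx),
    ENNReal.mul_rpow_of_nonneg _ _ hq]

theorem posPow_sum_le {ι : Type*} (s : Finset ι) {q : ℝ} (hq : 0 ≤ q) (a : ι → ℝ≥0∞) :
    posPow q (∑ i ∈ s, a i) ≤ (s.card : ℝ≥0∞) ^ q * ∑ i ∈ s, posPow q (a i) := by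
  rcases s.eq_empty_or_nonempty with rfl | hs
  · simp
  obtain ⟨m, hm, hmax⟩ := s.exists_max_image a hs
  calc posPow q (∑ i ∈ s, a i)
      ≤ posPow q (s.card * a m) :=
        posPow_mono hq ((Finset.sum_le_card_nsmul s a _ hmax).trans_eq (nsmul_eq_mul _ _))
    _ = (s.card : ℝ≥0∞) ^ q * posPow q (a m) := posPow_mul hq (by simp [hs.ne_empty]) _
    _ ≤ _ := by
        gcongr
        exact Finset.single_le_sum (f := fun i => posPow q (a i)) (fun _ _ => zero_le) hm

theorem posPow_measure_le_sum {ι X : Type*} [MeasurableSpace X] (ν : Measure X) {q : ℝ}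
    (hq : 0 ≤ q) {A : Set X} {s : Finset ι} {B : ι → Set X} (hAB : A ⊆ ⋃ i ∈ s, B i) :
    posPow q (ν A) ≤ (s.card : ℝ≥0∞) ^ q * ∑ i ∈ s, posPow q (ν (B i)) :=
  (posPow_mono hq ((measure_mono hAB).trans (measure_biUnion_finset_le s B))).trans
    (posPow_sum_le s hq _)

theorem posPow_weighted_sum_le {ι : Type*} (s : Finset ι) {q : ℝ} (hq : 1 ≤ q) (w a : ι → ℝ≥0∞)
    (hw : ∑ i ∈ s, w i = 1) :
    posPow q (∑ i ∈ s, w i * a i) ≤ ∑ i ∈ s, w i * posPow q (a i) := by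
  simp only [posPow_eq_rpow (zero_lt_one.trans_le hq)]
  exact ENNReal.rpow_arith_mean_le_arith_mean_rpow s w a hw hq

theorem weighted_sum_posPow_le {ι : Type*} (s : Finset ι) {q : ℝ} (hq : 0 ≤ q) (hq1 : q ≤ 1)
    (w a : ι → ℝ≥0∞) (hw : ∑ i ∈ s, w i = 1) :
    ∑ i ∈ s, w i * posPow q (a i) ≤ posPow q (∑ i ∈ s, w i * a i) := by
  rcases hq.eq_or_lt with rfl | hq0
  · by_cases h : ∑ i ∈ s, w i * a i = 0
    · rw [h, posPow_zero]
      refine (Finset.sum_eq_zero fun i hi => ?_).le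
      rcases mul_eq_zero.1 (Finset.sum_eq_zero_iff.1 h i hi) with h | h <;> simp [h]
    · rw [posPow_of_ne_zero _ h, ENNReal.rpow_zero, ← hw]
      refine Finset.sum_le_sum fun i _ => mul_le_of_le_one_right zero_le ?_
      unfold posPow
      split_ifs <;> simp
  · simp only [posPow_eq_rpow hq0]
    have h := ENNReal.rpow_arith_mean_le_arith_mean_rpow s w (fun i => a i ^ q) hw
      (one_le_inv_iff₀.2 ⟨hq0, hq1⟩)
    simp only [ENNReal.rpow_rpow_inv hq0.ne'] at h
    exact (ENNReal.rpow_inv_le_iff hq0).1 h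

/-! ### Measures of balls -/

section Balls

variable {X : Type*} [PseudoMetricSpace X] [MeasurableSpace X]

theorem measure_closedBall_eq_zero {ν : Measure X} {t x : X} {r a : ℝ}
    (hν : ν (closedBall t r)ᶜ = 0) (h : a + r < dist x t) : ν (closedBall x a) = 0 :=
  measure_mono_null
    (Set.subset_compl_iff_disjoint_right.2 (Metric.closedBall_disjoint_closedBall h)) hν

variable [OpensMeasurableSpace X] [SecondCountableTopology X]

theorem measurable_measure_closedBall (ν : Measure X) [SFinite ν] (r : ℝ) :
    Measurable fun x => ν (closedBall x r) :=
  measurable_measure_prodMk_left (ν := ν) (s := {z : X × X | dist z.2 z.1 ≤ r})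
    (isClosed_le (by fun_prop) (by fun_prop)).measurableSet

theorem lintegral_lintegral_closedBall (μ ν : Measure X) [SFinite μ] [SFinite ν] {g : X → ℝ≥0∞}
    (hg : Measurable g) (r : ℝ) :
    ∫⁻ y, ∫⁻ x in closedBall y r, g x ∂ν ∂μ = ∫⁻ x, μ (closedBall x r) * g x ∂ν := by
  have hclosed : IsClosed {z : X × X | dist z.2 z.1 ≤ r} :=
    isClosed_le (by fun_prop) (by fun_prop)
  calc ∫⁻ y, ∫⁻ x in closedBall y r, g x ∂ν ∂μ
      = ∫⁻ y, ∫⁻ x, {z : X × X | dist z.2 z.1 ≤ r}.indicator (fun z => g z.2) (y, x) ∂ν ∂μ :=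
        lintegral_congr fun y =>
          (lintegral_indicator Metric.isClosed_closedBall.measurableSet g).symm
    _ = ∫⁻ x, ∫⁻ y, {z : X × X | dist z.2 z.1 ≤ r}.indicator (fun z => g z.2) (y, x) ∂μ ∂ν :=
        lintegral_lintegral_swap
          ((hg.comp measurable_snd).indicator hclosed.measurableSet).aemeasurable
    _ = ∫⁻ x, ∫⁻ y, (closedBall x r).indicator (fun _ => g x) y ∂μ ∂ν := by
        simp only [Set.indicator, Set.mem_ofPred_eq, Metric.mem_closedBall, dist_comm]
    _ = ∫⁻ x, μ (closedBall x r) * g x ∂ν := by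
        refine lintegral_congr fun x => ?_
        rw [lintegral_indicator Metric.isClosed_closedBall.measurableSet, setLIntegral_const,
          mul_comm]

end Balls

/-! ### Moments of the measures of balls -/

/-- The average over the line of `ν (B(x, r)) ^ q` at scale `r`: a continuous substitute for the
mesh sum, chosen because it transforms exactly under similarities. -/
def ballMoment (ν : Measure ℝ) (q r : ℝ) : ℝ≥0∞ :=
  ENNReal.ofReal r⁻¹ * ∫⁻ x, posPow q (ν (closedBall x r))

theorem measurable_posPow_closedBall (ν : Measure ℝ) [SFinite ν] (q r : ℝ) :
    Measurable fun x => posPow q (ν (closedBall x r)) :=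
  (measurable_posPow q).comp (measurable_measure_closedBall ν r)

theorem lintegral_posPow_closedBall (ν : Measure ℝ) (q : ℝ) {r : ℝ} (hr : 0 < r) :
    ∫⁻ x, posPow q (ν (closedBall x r)) = ENNReal.ofReal r * ballMoment ν q r := by
  rw [ballMoment, ← mul_assoc, ← ENNReal.ofReal_mul hr.le, mul_inv_cancel₀ hr.ne',
    ENNReal.ofReal_one, one_mul]

theorem lintegral_setLIntegral_posPow_closedBall (ν : Measure ℝ) [SFinite ν] (q a : ℝ) {r : ℝ}
    (hr : 0 < r) :
    ∫⁻ y, ∫⁻ x in closedBall y a, posPow q (ν (closedBall x r)) =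
      ENNReal.ofReal (2 * a) * (ENNReal.ofReal r * ballMoment ν q r) := by
  rw [lintegral_lintegral_closedBall _ _ (measurable_posPow_closedBall ν q r)]
  simp only [Real.volume_closedBall]
  rw [lintegral_const_mul _ (measurable_posPow_closedBall ν q r),
    lintegral_posPow_closedBall ν q hr]

theorem ballMoment_mono_measure {ν κ : Measure ℝ} (h : ν ≤ κ) {q : ℝ} (hq : 0 ≤ q) (r : ℝ) :
    ballMoment ν q r ≤ ballMoment κ q r :=
  mul_le_mul_right (lintegral_mono fun _ => posPow_mono hq (h _)) _

theorem ballMoment_smul (ν : Measure ℝ) {q : ℝ} (hq : 0 ≤ q) {c : ℝ≥0∞} (hc : c ≠ 0)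
    (hc' : c ≠ ∞) (r : ℝ) : ballMoment (c • ν) q r = c ^ q * ballMoment ν q r := by
  simp only [ballMoment, Measure.smul_apply, smul_eq_mul, posPow_mul hq hc]
  rw [lintegral_const_mul' _ _ (ENNReal.rpow_ne_top_of_nonneg hq hc'), mul_left_comm]

theorem closedBall_subset_iUnion_closedBall {r r' : ℝ} (hr' : 0 < r') {n : ℕ} (h : r ≤ n * r')
    (x : ℝ) : closedBall x r ⊆ ⋃ i ∈ Finset.Icc (-n : ℤ) n, closedBall (x + i * r') r' := by
  intro z hz
  rw [Metric.mem_closedBall, Real.dist_eq] at hz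
  obtain ⟨hl, hu⟩ := abs_le.1 (hz.trans h)
  have hfloor := Int.floor_le ((z - x) / r')
  have hlt := Int.lt_floor_add_one ((z - x) / r')
  rw [le_div_iff₀ hr'] at hfloor
  rw [div_lt_iff₀ hr'] at hlt
  refine Set.mem_biUnion (x := ⌊(z - x) / r'⌋) (Finset.mem_Icc.2 ⟨?_, ?_⟩) ?_
  · rw [Int.le_floor, le_div_iff₀ hr']
    push_cast
    linarith
  · rw [← Int.cast_le (R := ℝ), ← mul_le_mul_iff_left₀ hr']
    exact hfloor.trans hu
  · rw [Metric.mem_closedBall, Real.dist_eq, abs_le]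
    constructor <;> linarith

theorem exists_ballMoment_le_of_le_mul {q : ℝ} (hq : 0 ≤ q) (K : ℝ) :
    ∃ C : ℝ≥0, ∀ (ν : Measure ℝ) [SFinite ν] (r r' : ℝ), 0 < r → 0 < r' → r ≤ K * r' →
      r' ≤ K * r → ballMoment ν q r ≤ C * ballMoment ν q r' := by
  set I := Finset.Icc (-⌈K⌉₊ : ℤ) ⌈K⌉₊
  refine ⟨K.toNNReal * ((I.card : ℝ≥0) ^ q * I.card), fun ν _ r r' hr hr' h h' => ?_⟩
  have hm := measurable_posPow_closedBall ν q r'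
  have hK : r ≤ ⌈K⌉₊ * r' := h.trans (by gcongr; exact Nat.le_ceil K)
  have hint : ∫⁻ x, posPow q (ν (closedBall x r)) ≤
      (I.card : ℝ≥0∞) ^ q * (I.card * ∫⁻ x, posPow q (ν (closedBall x r'))) :=
    calc ∫⁻ x, posPow q (ν (closedBall x r))
        ≤ ∫⁻ x, (I.card : ℝ≥0∞) ^ q * ∑ i ∈ I, posPow q (ν (closedBall (x + i * r') r')) :=
          lintegral_mono fun x =>
            posPow_measure_le_sum ν hq (closedBall_subset_iUnion_closedBall hr' hK x)
      _ = (I.card : ℝ≥0∞) ^ q * ∑ i ∈ I, ∫⁻ x, posPow q (ν (closedBall (x + i * r') r')) := by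
          have hi : ∀ i ∈ I, Measurable fun x => posPow q (ν (closedBall (x + i * r') r')) :=
            fun i _ => hm.comp (measurable_add_const _)
          rw [lintegral_const_mul _ (Finset.measurable_fun_sum _ hi), lintegral_finsetSum _ hi]
      _ = _ := by
          simp only [lintegral_add_right_eq_self fun x => posPow q (ν (closedBall x r')),
            Finset.sum_const, nsmul_eq_mul]
  have hinv : ENNReal.ofReal r⁻¹ ≤ ENNReal.ofReal K * ENNReal.ofReal r'⁻¹ := by
    rw [← ENNReal.ofReal_mul' (inv_pos.2 hr').le]
    refine ENNReal.ofReal_le_ofReal ?_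
    rw [← div_eq_mul_inv, le_div_iff₀ hr', inv_mul_le_iff₀ hr, mul_comm]
    exact h'
  refine (mul_le_mul' hinv hint).trans_eq ?_
  rw [ballMoment, ENNReal.ofReal, ENNReal.coe_mul, ENNReal.coe_mul,
    ENNReal.coe_rpow_of_nonneg _ hq, ENNReal.coe_natCast]
  ring

theorem lintegral_comp_sub_div {g : ℝ → ℝ≥0∞} (hg : Measurable g) {c : ℝ} (hc : c ≠ 0) (t : ℝ) :
    ∫⁻ x, g ((x - t) / c) = ENNReal.ofReal |c| * ∫⁻ x, g x := by
  rw [lintegral_sub_right_eq_self (fun x => g (x / c)) t]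
  conv_lhs => rw [← Real.smul_map_volume_mul_left hc]
  rw [lintegral_smul_measure, lintegral_map (by fun_prop) (by fun_prop), smul_eq_mul]
  simp only [mul_div_cancel_left₀ _ hc]

theorem map_affine_closedBall (ν : Measure ℝ) {c : ℝ} (hc : c ≠ 0) (t x r : ℝ) :
    ν.map (fun y => c * y + t) (closedBall x r) = ν (closedBall ((x - t) / c) (r / |c|)) := by
  rw [Measure.map_apply (by fun_prop) Metric.isClosed_closedBall.measurableSet]
  congr 1
  ext y
  simp only [Set.mem_preimage, Metric.mem_closedBall, Real.dist_eq]
  rw [le_div_iff₀ (abs_pos.2 hc), ← abs_mul, sub_mul, div_mul_cancel₀ _ hc]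
  ring_nf

theorem ballMoment_map_affine (ν : Measure ℝ) [SFinite ν] (q : ℝ) {c : ℝ} (hc : c ≠ 0) (t r : ℝ) :
    ballMoment (ν.map fun y => c * y + t) q r = ballMoment ν q (r / |c|) := by
  simp only [ballMoment, map_affine_closedBall ν hc]
  rw [lintegral_comp_sub_div (measurable_posPow_closedBall ν q (r / |c|)) hc, ← mul_assoc,
    ← ENNReal.ofReal_mul' (abs_nonneg c), inv_div, inv_mul_eq_div]

theorem setLIntegral_posPow_closedBall {ν : Measure ℝ} {y a : ℝ} (hν : ν (closedBall y a)ᶜ = 0)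
    (q r : ℝ) :
    ∫⁻ x in closedBall y (r + a), posPow q (ν (closedBall x r)) =
      ∫⁻ x, posPow q (ν (closedBall x r)) := by
  refine setLIntegral_eq_of_support_subset fun x hx => ?_
  by_contra h
  rw [Metric.mem_closedBall, not_le] at h
  exact hx (by simp only [measure_closedBall_eq_zero hν h, posPow_zero])

theorem ballMoment_ne_top {ν : Measure ℝ} [IsFiniteMeasure ν] {q : ℝ} (hq : 0 ≤ q) {y a : ℝ}
    (hν : ν (closedBall y a)ᶜ = 0) (r : ℝ) : ballMoment ν q r ≠ ∞ := by
  refine ENNReal.mul_ne_top ENNReal.ofReal_ne_top ?_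
  rw [← setLIntegral_posPow_closedBall hν]
  refine (lt_of_le_of_lt (setLIntegral_mono measurable_const fun x _ =>
    posPow_mono hq (measure_mono (Set.subset_univ _))) ?_).ne
  rw [setLIntegral_const, Real.volume_closedBall]
  exact (ENNReal.mul_ne_top (posPow_ne_top hq (measure_ne_top ν _)) ENNReal.ofReal_ne_top).lt_top

theorem ballMoment_ne_zero (ν : Measure ℝ) [SFinite ν] [NeZero ν] {q : ℝ} (hq : 0 ≤ q) {r : ℝ}
    (hr : 0 < r) : ballMoment ν q r ≠ 0 := by
  intro h0
  have hzero : ∀ᵐ x, ν (closedBall x r) = 0 := by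
    have h := lintegral_posPow_closedBall ν q hr
    rw [h0, mul_zero, lintegral_eq_zero_iff (measurable_posPow_closedBall ν q r)] at h
    exact h.mono fun x hx => (posPow_eq_zero hq).1 hx
  have hmass : ∫⁻ x, ν (closedBall x r) = ENNReal.ofReal (2 * r) * ν Set.univ := by
    simpa using lintegral_lintegral_closedBall volume ν (g := fun _ => 1) measurable_const r
  rw [lintegral_congr_ae hzero, lintegral_zero, eq_comm, mul_eq_zero, ENNReal.ofReal_eq_zero,
    Measure.measure_univ_eq_zero] at hmass
  exact hmass.elim (fun h => by linarith) (NeZero.ne ν)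

/-! ### Comparison with mesh sums -/

/-- The sum `meshSum` with values in `[0, ∞]`, where summability is not an issue. -/
def meshMoment (ν : Measure ℝ) (q δ : ℝ) : ℝ≥0∞ :=
  ∑' k : ℤ, posPow q (ν (Set.Icc (k * δ) ((k + 1) * δ)))

theorem toReal_meshMoment (ν : Measure ℝ) [IsFiniteMeasure ν] {q : ℝ} (hq : 0 ≤ q) (δ : ℝ) :
    (meshMoment ν q δ).toReal = meshSum ν q δ := by
  unfold meshMoment meshSum
  rw [ENNReal.tsum_toReal_eq fun k => posPow_ne_top hq (measure_ne_top _ _)]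
  refine tsum_congr fun k => ?_
  unfold posPow
  split_ifs
  exacts [ENNReal.toReal_zero, (ENNReal.toReal_rpow _ _).symm]

theorem ballMoment_eq_tsum (ν : Measure ℝ) (q : ℝ) {δ : ℝ} (hδ : 0 < δ) :
    ballMoment ν q δ = ∑' k : ℤ, ENNReal.ofReal δ⁻¹ *
      ∫⁻ x in Set.Ico (k * δ) ((k + 1) * δ), posPow q (ν (closedBall x δ)) := by
  have hcover := iUnion_Ico_zsmul hδ
  have hdisj := Set.pairwise_disjoint_Ico_zsmul δ
  simp only [zsmul_eq_mul, Int.cast_add, Int.cast_one] at hcover hdisj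
  rw [ENNReal.tsum_mul_left, ← lintegral_iUnion (fun k => measurableSet_Ico) hdisj, hcover,
    setLIntegral_univ, ballMoment]

theorem ofReal_inv_mul_setLIntegral_Ico_const {δ : ℝ} (hδ : 0 < δ) (k : ℝ) (m : ℝ≥0∞) :
    ENNReal.ofReal δ⁻¹ * ∫⁻ _ in Set.Ico (k * δ) ((k + 1) * δ), m = m := by
  have hlen : δ⁻¹ * ((k + 1) * δ - k * δ) = 1 := by
    field_simp
    ring
  rw [setLIntegral_const, Real.volume_Ico, mul_left_comm, ← ENNReal.ofReal_mul (inv_pos.2 hδ).le,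
    hlen, ENNReal.ofReal_one, mul_one]

theorem meshMoment_le_ballMoment (ν : Measure ℝ) {q : ℝ} (hq : 0 ≤ q) {δ : ℝ} (hδ : 0 < δ) :
    meshMoment ν q δ ≤ ballMoment ν q δ := by
  rw [ballMoment_eq_tsum ν q hδ]
  refine ENNReal.tsum_le_tsum fun k => ?_
  rw [← ofReal_inv_mul_setLIntegral_Ico_const hδ k (posPow _ _)]
  gcongr ENNReal.ofReal δ⁻¹ * ?_
  refine setLIntegral_mono' measurableSet_Ico fun x hx => posPow_mono hq (measure_mono ?_)
  rw [Real.closedBall_eq_Icc]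
  exact Set.Icc_subset_Icc (by linarith [hx.2]) (by linarith [hx.1])

theorem closedBall_subset_iUnion_mesh {δ x : ℝ} {k : ℤ}
    (hx : x ∈ Set.Ico (k * δ) ((k + 1) * δ)) :
    closedBall x δ ⊆ ⋃ i ∈ Finset.Icc (-1 : ℤ) 1,
      Set.Icc (((k + i : ℤ) : ℝ) * δ) (((k + i : ℤ) + 1) * δ) := by
  intro z hz
  rw [Real.closedBall_eq_Icc] at hz
  obtain ⟨hz1, hz2⟩ := hz
  obtain ⟨hx1, hx2⟩ := hx
  rcases le_total z (k * δ) with h | h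
  · exact Set.mem_biUnion (x := -1) (by decide) (by push_cast; constructor <;> linarith)
  rcases le_total z ((k + 1) * δ) with h' | h'
  · exact Set.mem_biUnion (x := 0) (by decide) (by push_cast; constructor <;> linarith)
  · exact Set.mem_biUnion (x := 1) (by decide) (by push_cast; constructor <;> linarith)

theorem ballMoment_le_mul_meshMoment (ν : Measure ℝ) {q : ℝ} (hq : 0 ≤ q) {δ : ℝ} (hδ : 0 < δ) :
    ballMoment ν q δ ≤ 3 ^ q * 3 * meshMoment ν q δ := by
  set m : ℤ → ℝ≥0∞ := fun k => posPow q (ν (Set.Icc (k * δ) ((k + 1) * δ)))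
  have hcell : ∀ k : ℤ, ENNReal.ofReal δ⁻¹ *
      ∫⁻ x in Set.Ico (k * δ) ((k + 1) * δ), posPow q (ν (closedBall x δ)) ≤
        3 ^ q * ∑ i ∈ Finset.Icc (-1 : ℤ) 1, m (k + i) := fun k => by
    rw [← ofReal_inv_mul_setLIntegral_Ico_const hδ k (3 ^ q * _)]
    gcongr ENNReal.ofReal δ⁻¹ * ?_
    exact setLIntegral_mono' measurableSet_Ico fun x hx =>
      posPow_measure_le_sum ν hq (closedBall_subset_iUnion_mesh hx)
  calc ballMoment ν q δ
      ≤ ∑' k, 3 ^ q * ∑ i ∈ Finset.Icc (-1 : ℤ) 1, m (k + i) := by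
        rw [ballMoment_eq_tsum ν q hδ]
        exact ENNReal.tsum_le_tsum hcell
    _ = 3 ^ q * ∑ i ∈ Finset.Icc (-1 : ℤ) 1, ∑' k, m (k + i) := by
        rw [ENNReal.tsum_mul_left, Summable.tsum_finsetSum fun _ _ => ENNReal.summable]
    _ = 3 ^ q * 3 * meshMoment ν q δ := by
        have hshift : ∀ i : ℤ, ∑' k, m (k + i) = meshMoment ν q δ := fun i =>
          (Equiv.addRight i).tsum_eq m
        simp only [hshift, Finset.sum_const, nsmul_eq_mul, mul_assoc]
        rfl

theorem toReal_le_mul_toReal {x y : ℝ≥0∞} {C : ℝ≥0} (h : x ≤ C * y) (hy : y ≠ ∞) :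
    x.toReal ≤ C * y.toReal := by
  simpa using ENNReal.toReal_mono (ENNReal.mul_ne_top ENNReal.coe_ne_top hy) h

theorem isBigO_toReal {α : Type*} {l : Filter α} {f g : α → ℝ≥0∞} {C : ℝ≥0}
    (h : ∀ᶠ x in l, f x ≤ C * g x) (hg : ∀ᶠ x in l, g x ≠ ∞) :
    (fun x => (f x).toReal) =O[l] fun x => (g x).toReal := by
  refine Asymptotics.IsBigO.of_bound C ((h.and hg).mono fun x hx => ?_)
  simpa using toReal_le_mul_toReal hx.1 hx.2

theorem isTheta_toReal_ballMoment_meshSum {ν : Measure ℝ} [IsFiniteMeasure ν] {q : ℝ}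
    (hq : 0 ≤ q) {y a : ℝ} (hν : ν (closedBall y a)ᶜ = 0) :
    (fun δ => (ballMoment ν q δ).toReal) =Θ[𝓝[>] 0] meshSum ν q := by
  have htop : ∀ δ > 0, meshMoment ν q δ ≠ ∞ := fun δ hδ =>
    ne_top_of_le_ne_top (ballMoment_ne_top hq hν δ) (meshMoment_le_ballMoment ν hq hδ)
  have hmesh : meshSum ν q = fun δ => (meshMoment ν q δ).toReal :=
    funext fun δ => (toReal_meshMoment ν hq δ).symm
  rw [hmesh]
  constructor
  · refine isBigO_toReal (C := 3 ^ q * 3) ?_ (eventually_mem_nhdsWithin.mono htop)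
    filter_upwards [self_mem_nhdsWithin] with δ hδ
    simpa [ENNReal.coe_rpow_of_nonneg _ hq] using ballMoment_le_mul_meshMoment ν hq hδ
  · refine isBigO_toReal (C := 1) ?_ (Eventually.of_forall fun δ => ballMoment_ne_top hq hν δ)
    filter_upwards [self_mem_nhdsWithin] with δ hδ
    simpa using meshMoment_le_ballMoment ν hq hδ

/-! ### Moments of mixtures -/

section Mixture

theorem measure_eq_zero_of_mem_span {X : Type*} [MeasurableSpace X] {K : Set (Measure X)}
    {ν : Measure X} (hν : ν ∈ Submodule.span ℝ≥0∞ K) {s : Set X} (hs : ∀ κ ∈ K, κ s = 0) :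
    ν s = 0 := by
  induction hν using Submodule.span_induction with
  | mem κ hκ => exact hs κ hκ
  | zero => simp
  | add κ₁ κ₂ _ _ h₁ h₂ => simp [h₁, h₂]
  | smul c κ _ h => simp [h]

theorem exists_eq_add_of_mem_span {X : Type*} [PseudoMetricSpace X] [MeasurableSpace X]
    {K : Set (Measure X)} {r : ℝ} (hK : ∀ κ ∈ K, ∃ t, κ (closedBall t r)ᶜ = 0)
    {ν : Measure X} (hν : ν ∈ Submodule.span ℝ≥0∞ K) (y : X) (a : ℝ) :
    ∃ ν₁ ∈ Submodule.span ℝ≥0∞ K, ∃ ν₂, ν = ν₁ + ν₂ ∧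
      ν₁ (closedBall y (a + 2 * r))ᶜ = 0 ∧ ν₂ (closedBall y a) = 0 := by
  have hsplit : K = {κ ∈ K | κ (closedBall y a) ≠ 0} ∪ {κ ∈ K | κ (closedBall y a) = 0} := by
    ext κ
    simp only [Set.mem_union, Set.mem_sep_iff]
    tauto
  rw [hsplit, Submodule.span_union] at hν
  obtain ⟨ν₁, h₁, ν₂, h₂, rfl⟩ := Submodule.mem_sup.1 hν
  refine ⟨ν₁, Submodule.span_mono (Set.sep_subset _ _) h₁, ν₂, rfl,
    measure_eq_zero_of_mem_span h₁ ?_, measure_eq_zero_of_mem_span h₂ fun κ hκ => hκ.2⟩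
  rintro κ ⟨hκ, hy⟩
  obtain ⟨t, ht⟩ := hK κ hκ
  have hdist : dist y t ≤ a + r := not_lt.1 fun h => hy (measure_closedBall_eq_zero ht h)
  refine measure_mono_null (Set.compl_subset_compl.2 (Metric.closedBall_subset_closedBall' ?_)) ht
  linarith [dist_comm t y]

theorem exists_average_of_mem_span {X : Type*} [MeasurableSpace X] {K : Set (Measure X)}
    (hK : ∀ κ ∈ K, IsProbabilityMeasure κ) {ν : Measure X} [IsFiniteMeasure ν] [NeZero ν]
    (hν : ν ∈ Submodule.span ℝ≥0∞ K) :
    ∃ (n : ℕ) (w : Fin n → ℝ≥0∞) (κ : Fin n → Measure X), ∑ i, w i = 1 ∧ (∀ i, κ i ∈ K) ∧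
      ν = ν Set.univ • ∑ i, w i • κ i := by
  obtain ⟨n, w, κ, hsum⟩ := Submodule.mem_span_set'.1 hν
  have hmass : ν Set.univ = ∑ i, w i := by
    have h : ∀ i, (κ i : Measure X) Set.univ = 1 := fun i =>
      have := hK _ (κ i).2
      measure_univ
    simp [← hsum, h]
  have h0 : ν Set.univ ≠ 0 := Measure.measure_univ_ne_zero.2 (NeZero.ne ν)
  refine ⟨n, fun i => (ν Set.univ)⁻¹ * w i, fun i => κ i, ?_, fun i => (κ i).2, ?_⟩
  · rw [← Finset.mul_sum, ← hmass, ENNReal.inv_mul_cancel h0 (measure_ne_top ν _)]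
  · simp only [mul_smul]
    rw [← Finset.smul_sum, hsum, smul_smul, ENNReal.mul_inv_cancel h0 (measure_ne_top ν _),
      one_smul]

variable {ι : Type*} [Fintype ι] {w : ι → ℝ≥0∞} {κ : ι → Measure ℝ} [∀ i, SFinite (κ i)]

theorem sum_mul_ballMoment_eq (w : ι → ℝ≥0∞) (q r : ℝ) :
    ∑ i, w i * ballMoment (κ i) q r =
      ENNReal.ofReal r⁻¹ * ∫⁻ x, ∑ i, w i * posPow q (κ i (closedBall x r)) := by
  have hm := fun i => measurable_posPow_closedBall (κ i) q r
  rw [lintegral_finsetSum _ fun i _ => (hm i).const_mul _, Finset.mul_sum]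
  refine Finset.sum_congr rfl fun i _ => ?_
  rw [lintegral_const_mul _ (hm i), ballMoment, mul_left_comm]

theorem ballMoment_weighted_sum_le {q : ℝ} (hq : 1 ≤ q) (hw : ∑ i, w i = 1) (r : ℝ) :
    ballMoment (∑ i, w i • κ i) q r ≤ ∑ i, w i * ballMoment (κ i) q r := by
  rw [sum_mul_ballMoment_eq, ballMoment]
  gcongr ENNReal.ofReal r⁻¹ * ?_
  refine lintegral_mono fun x => ?_
  simpa using posPow_weighted_sum_le Finset.univ hq w _ hw

theorem weighted_sum_ballMoment_le {q : ℝ} (hq : 0 ≤ q) (hq1 : q ≤ 1) (hw : ∑ i, w i = 1) (r : ℝ) :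
    ∑ i, w i * ballMoment (κ i) q r ≤ ballMoment (∑ i, w i • κ i) q r := by
  rw [sum_mul_ballMoment_eq, ballMoment]
  gcongr ENNReal.ofReal r⁻¹ * ?_
  refine lintegral_mono fun x => ?_
  simpa using weighted_sum_posPow_le Finset.univ hq hq1 w _ hw

end Mixture

section Span

variable {K : Set (Measure ℝ)} (hprob : ∀ κ ∈ K, IsProbabilityMeasure κ)
  {ν : Measure ℝ} [IsFiniteMeasure ν] (hν : ν ∈ Submodule.span ℝ≥0∞ K) {N : ℝ≥0∞}

include hprob hν

theorem ballMoment_le_of_mem_span {q : ℝ} (hq : 1 ≤ q) {r : ℝ}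
    (hN : ∀ κ ∈ K, ballMoment κ q r ≤ N) :
    ballMoment ν q r ≤ posPow q (ν Set.univ) * N := by
  rcases eq_or_ne ν 0 with rfl | h0
  · simp [ballMoment]
  have : NeZero ν := ⟨h0⟩
  obtain ⟨n, w, κ, hw, hκ, heq⟩ := exists_average_of_mem_span hprob hν
  have := fun i => hprob _ (hκ i)
  have hmass : ν Set.univ ≠ 0 := Measure.measure_univ_ne_zero.2 h0
  calc ballMoment ν q r = ν Set.univ ^ q * ballMoment (∑ i, w i • κ i) q r := by
        conv_lhs => rw [heq]
        exact ballMoment_smul _ (zero_le_one.trans hq) hmass (measure_ne_top ν _) r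
    _ ≤ ν Set.univ ^ q * ∑ i, w i * N := by
        gcongr
        exact (ballMoment_weighted_sum_le hq hw r).trans (by gcongr with i; exact hN _ (hκ i))
    _ = posPow q (ν Set.univ) * N := by
        rw [← Finset.sum_mul, hw, one_mul, posPow_of_ne_zero q hmass]

theorem le_ballMoment_of_mem_span {q : ℝ} (hq : 0 ≤ q) (hq1 : q ≤ 1) {r : ℝ}
    (hN : ∀ κ ∈ K, N ≤ ballMoment κ q r) :
    posPow q (ν Set.univ) * N ≤ ballMoment ν q r := by
  rcases eq_or_ne ν 0 with rfl | h0
  · simp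
  have : NeZero ν := ⟨h0⟩
  obtain ⟨n, w, κ, hw, hκ, heq⟩ := exists_average_of_mem_span hprob hν
  have := fun i => hprob _ (hκ i)
  have hmass : ν Set.univ ≠ 0 := Measure.measure_univ_ne_zero.2 h0
  calc posPow q (ν Set.univ) * N = ν Set.univ ^ q * ∑ i, w i * N := by
        rw [← Finset.sum_mul, hw, one_mul, posPow_of_ne_zero q hmass]
    _ ≤ ν Set.univ ^ q * ballMoment (∑ i, w i • κ i) q r := by
        gcongr
        exact le_trans (by gcongr with i; exact hN _ (hκ i))
          (weighted_sum_ballMoment_le hq hq1 hw r)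
    _ = ballMoment ν q r := by
        conv_rhs => rw [heq]
        exact (ballMoment_smul _ hq hmass (measure_ne_top ν _) r).symm

variable {r r' : ℝ} (hcarried : ∀ κ ∈ K, ∃ t, κ (closedBall t r)ᶜ = 0) (hr' : 0 < r')

include hcarried hr'

-- Only the measures of `K` that charge `B(y, 2 * r)` contribute to the left-hand side; they are
-- carried by `B(y, 4 * r)`, so that their total mass in `ν` is at most `ν (B(y, 4 * r))`.
theorem setLIntegral_posPow_closedBall_le_of_mem_span {q : ℝ} (hq : 1 ≤ q) (hr : r' ≤ r)
    (hN : ∀ κ ∈ K, ballMoment κ q r' ≤ N) (y : ℝ) :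
    ∫⁻ x in closedBall y r, posPow q (ν (closedBall x r')) ≤
      ENNReal.ofReal r' * N * posPow q (ν (closedBall y (4 * r))) := by
  obtain ⟨ν₁, hν₁, ν₂, rfl, h₁, h₂⟩ := exists_eq_add_of_mem_span hcarried hν y (2 * r)
  have : IsFiniteMeasure ν₁ := isFiniteMeasure_of_le (ν₁ + ν₂) (Measure.le_add_right le_rfl)
  have hmass : ν₁ Set.univ ≤ (ν₁ + ν₂) (closedBall y (4 * r)) := by
    rw [← measure_add_measure_compl (Metric.isClosed_closedBall (x := y)).measurableSet, h₁,
      add_zero, Measure.add_apply, show 2 * r + 2 * r = 4 * r by ring]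
    exact le_self_add
  calc ∫⁻ x in closedBall y r, posPow q ((ν₁ + ν₂) (closedBall x r'))
      ≤ ∫⁻ x in closedBall y r, posPow q (ν₁ (closedBall x r')) := by
        refine setLIntegral_mono (measurable_posPow_closedBall ν₁ q r') fun x hx => ?_
        have hsub : closedBall x r' ⊆ closedBall y (2 * r) :=
          Metric.closedBall_subset_closedBall' (by linarith [Metric.mem_closedBall.1 hx])
        rw [Measure.add_apply, measure_mono_null hsub h₂, add_zero]
    _ ≤ ENNReal.ofReal r' * ballMoment ν₁ q r' :=
        (setLIntegral_le_lintegral _ _).trans_eq (lintegral_posPow_closedBall ν₁ q hr')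
    _ ≤ ENNReal.ofReal r' * (posPow q ((ν₁ + ν₂) (closedBall y (4 * r))) * N) := by
        gcongr
        refine (ballMoment_le_of_mem_span hprob hν₁ hq hN).trans ?_
        gcongr
        exact posPow_mono (zero_le_one.trans hq) hmass
    _ = _ := by ring

theorem ballMoment_le_mul_ballMoment_of_mem_span {q : ℝ} (hq : 1 ≤ q) (hr : r' ≤ r)
    (hN : ∀ κ ∈ K, ballMoment κ q r' ≤ N) :
    ballMoment ν q r' ≤ 2 * N * ballMoment ν q (4 * r) := by
  have hr0 : 0 < r := hr'.trans_le hr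
  have hfour : ENNReal.ofReal (4 * r) = 2 * ENNReal.ofReal (2 * r) := by
    rw [← ENNReal.ofReal_ofNat 2, ← ENNReal.ofReal_mul zero_le_two]
    ring_nf
  have hint := lintegral_mono (μ := volume)
    (setLIntegral_posPow_closedBall_le_of_mem_span hprob hν hcarried hr' hq hr hN)
  rw [lintegral_setLIntegral_posPow_closedBall ν q r hr',
    lintegral_const_mul _ (measurable_posPow_closedBall ν q (4 * r)),
    lintegral_posPow_closedBall ν q (by positivity), hfour] at hint
  have hpos : ENNReal.ofReal (2 * r) * ENNReal.ofReal r' ≠ 0 := by simp [hr0, hr']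
  refine (ENNReal.mul_le_mul_iff_right hpos (by finiteness)).1 ?_
  calc _ = _ := mul_assoc _ _ _
    _ ≤ _ := hint
    _ = _ := by ring

theorem mul_posPow_le_setLIntegral_of_mem_span {q : ℝ} (hq : 0 ≤ q) (hq1 : q ≤ 1) (hr : r' ≤ r)
    (hN : ∀ κ ∈ K, N ≤ ballMoment κ q r') (y : ℝ) :
    ENNReal.ofReal r' * N * posPow q (ν (closedBall y r)) ≤
      ∫⁻ x in closedBall y (4 * r), posPow q (ν (closedBall x r')) := by
  obtain ⟨ν₁, hν₁, ν₂, rfl, h₁, h₂⟩ := exists_eq_add_of_mem_span hcarried hν y r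
  have hle : ν₁ ≤ ν₁ + ν₂ := Measure.le_add_right le_rfl
  have : IsFiniteMeasure ν₁ := isFiniteMeasure_of_le _ hle
  calc ENNReal.ofReal r' * N * posPow q ((ν₁ + ν₂) (closedBall y r))
      = ENNReal.ofReal r' * (posPow q (ν₁ (closedBall y r)) * N) := by
        rw [Measure.add_apply, h₂, add_zero]
        ring
    _ ≤ ENNReal.ofReal r' * ballMoment ν₁ q r' := by
        gcongr
        refine le_trans ?_ (le_ballMoment_of_mem_span hprob hν₁ hq hq1 hN)
        gcongr
        exact posPow_mono hq (measure_mono (Set.subset_univ _))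
    _ = ∫⁻ x in closedBall y (r' + (r + 2 * r)), posPow q (ν₁ (closedBall x r')) := by
        rw [setLIntegral_posPow_closedBall h₁, lintegral_posPow_closedBall ν₁ q hr']
    _ ≤ ∫⁻ x in closedBall y (4 * r), posPow q (ν₁ (closedBall x r')) :=
        lintegral_mono_set (Metric.closedBall_subset_closedBall (by linarith))
    _ ≤ ∫⁻ x in closedBall y (4 * r), posPow q ((ν₁ + ν₂) (closedBall x r')) :=
        lintegral_mono fun x => posPow_mono hq (hle _)

theorem mul_ballMoment_le_ballMoment_of_mem_span {q : ℝ} (hq : 0 ≤ q) (hq1 : q ≤ 1) (hr : r' ≤ r)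
    (hN : ∀ κ ∈ K, N ≤ ballMoment κ q r') :
    N * ballMoment ν q r ≤ 8 * ballMoment ν q r' := by
  have hr0 : 0 < r := hr'.trans_le hr
  have hint := lintegral_mono (μ := volume)
    (mul_posPow_le_setLIntegral_of_mem_span hprob hν hcarried hr' hq hq1 hr hN)
  rw [lintegral_setLIntegral_posPow_closedBall ν q (4 * r) hr',
    lintegral_const_mul _ (measurable_posPow_closedBall ν q r),
    lintegral_posPow_closedBall ν q hr0, show 2 * (4 * r) = 8 * r by ring,
    ENNReal.ofReal_mul (by positivity : (0 : ℝ) ≤ 8), ENNReal.ofReal_ofNat] at hint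
  have hpos : ENNReal.ofReal r * ENNReal.ofReal r' ≠ 0 := by simp [hr0, hr']
  refine (ENNReal.mul_le_mul_iff_right hpos (by finiteness)).1 ?_
  calc _ = _ := by ring
    _ ≤ _ := hint
    _ = _ := by ring

end Span

/-! ### Graph-directed self-similar measures on the line -/

/-- A family of compactly supported probability measures on the line with
`ν s = ∑ p_e ν_{t(e)} ∘ f_e⁻¹`, the sum over the edges `e` leaving `s`, where
`f_e x = c_e x + t_e` are contracting similarities. -/
structure IsSelfSimilarFamily {S E : Type*} [DecidableEq S] [Fintype E] (src tgt : E → S)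
    (p : E → ℝ≥0∞) (c t : E → ℝ) (ν : S → Measure ℝ) : Prop where
  isProbability : ∀ s, IsProbabilityMeasure (ν s)
  bounded : ∃ R : ℝ, ∀ s, ν s (closedBall 0 R)ᶜ = 0
  weight_ne_zero : ∀ e, p e ≠ 0
  weight_ne_top : ∀ e, p e ≠ ∞
  ratio_ne_zero : ∀ e, c e ≠ 0
  ratio_lt_one : ∀ e, |c e| < 1
  selfSimilar : ∀ s, ν s = ∑ e with src e = s, p e • (ν (tgt e)).map fun x => c e * x + t e

section Copies

variable {S E : Type*} (src tgt : E → S)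

/-- There is a directed path, possibly of length zero, between two vertices. -/
def Reachable : S → S → Prop :=
  Relation.ReflTransGen fun u u' => ∃ e, src e = u ∧ tgt e = u'

/-- The similar copies of the measures `ν u`, with `u` reachable from `s`, by ratios comparable
to `δ` up to the factor `K`. -/
def copies (ν : S → Measure ℝ) (K δ : ℝ) (s : S) : Set (Measure ℝ) :=
  {κ | ∃ u a b, Reachable src tgt s u ∧ |a| ≤ δ ∧ δ ≤ K * |a| ∧ κ = (ν u).map fun x => a * x + b}

variable {src tgt} {ν : S → Measure ℝ} {K δ : ℝ}

theorem map_affine_mem_copies {κ : Measure ℝ} {e : E} {c : ℝ} (hc : c ≠ 0) (t : ℝ)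
    (hκ : κ ∈ copies src tgt ν K (δ / |c|) (tgt e)) :
    (κ.map fun x => c * x + t) ∈ copies src tgt ν K δ (src e) := by
  obtain ⟨u, a, b, hu, ha, ha', rfl⟩ := hκ
  have hc0 : 0 < |c| := abs_pos.2 hc
  refine ⟨u, c * a, c * b + t, hu.head ⟨e, rfl, rfl⟩, ?_, ?_, ?_⟩
  · rwa [abs_mul, mul_comm, ← le_div_iff₀ hc0]
  · rwa [abs_mul, mul_comm |c|, ← mul_assoc, ← div_le_iff₀ hc0]
  · rw [Measure.map_map (by fun_prop) (by fun_prop)]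
    congr 1
    funext x
    simp only [Function.comp_apply]
    ring

theorem map_affine_mem_span_copies {κ : Measure ℝ} {e : E} {c : ℝ} (hc : c ≠ 0) (t : ℝ)
    (hκ : κ ∈ Submodule.span ℝ≥0∞ (copies src tgt ν K (δ / |c|) (tgt e))) :
    (κ.map fun x => c * x + t) ∈ Submodule.span ℝ≥0∞ (copies src tgt ν K δ (src e)) := by
  have hm : Measurable fun x : ℝ => c * x + t := by fun_prop
  rw [← Measure.mapₗ_apply_of_measurable hm]
  refine (Submodule.map_span_le (Measure.mapₗ fun x => c * x + t) _ _).2 (fun κ' hκ' => ?_)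
    (Submodule.mem_map_of_mem hκ)
  rw [Measure.mapₗ_apply_of_measurable hm]
  exact Submodule.subset_span (map_affine_mem_copies hc t hκ')

theorem isProbabilityMeasure_of_mem_copies (hν : ∀ s, IsProbabilityMeasure (ν s)) {s : S}
    {κ : Measure ℝ} (hκ : κ ∈ copies src tgt ν K δ s) : IsProbabilityMeasure κ := by
  obtain ⟨u, a, b, -, -, -, rfl⟩ := hκ
  have := hν u
  exact Measure.isProbabilityMeasure_map (by fun_prop)

theorem exists_carried_of_mem_copies {R : ℝ} (hR0 : 0 ≤ R) (hR : ∀ s, ν s (closedBall 0 R)ᶜ = 0)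
    {s : S} {κ : Measure ℝ} (hκ : κ ∈ copies src tgt ν K δ s) :
    ∃ t, κ (closedBall t (R * δ))ᶜ = 0 := by
  obtain ⟨u, a, b, -, ha, -, rfl⟩ := hκ
  refine ⟨b, ?_⟩
  rw [Measure.map_apply (by fun_prop) Metric.isClosed_closedBall.measurableSet.compl]
  refine measure_mono_null (t := (closedBall 0 R)ᶜ) (fun x hx hx' => hx ?_) (hR u)
  simp only [Metric.mem_closedBall, Real.dist_eq, sub_zero, add_sub_cancel_right, abs_mul]
    at hx' ⊢
  rw [mul_comm]
  gcongr

theorem exists_ballMoment_copy_comparable (hν : ∀ s, IsProbabilityMeasure (ν s)) {q : ℝ}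
    (hq : 0 ≤ q) (hK : 1 ≤ K) :
    ∃ C : ℝ≥0, ∀ δ δ', 0 < δ → 0 < δ' → ∀ s, ∀ κ ∈ copies src tgt ν K δ s,
      ∃ u, Reachable src tgt s u ∧ ballMoment κ q (δ * δ') ≤ C * ballMoment (ν u) q δ' ∧
        ballMoment (ν u) q δ' ≤ C * ballMoment κ q (δ * δ') := by
  obtain ⟨C, hC⟩ := exists_ballMoment_le_of_le_mul hq K
  refine ⟨C, fun δ δ' hδ hδ' s κ hκ => ?_⟩
  obtain ⟨u, a, b, hu, ha, ha', rfl⟩ := hκ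
  have ha0 : 0 < |a| := pos_of_mul_pos_right (hδ.trans_le ha') (zero_le_one.trans hK)
  have hle : δ * δ' / |a| ≤ K * δ' := by
    rw [div_le_iff₀ ha0, mul_right_comm]
    gcongr
  have hle' : δ' ≤ K * (δ * δ' / |a|) := by
    rw [← mul_div_assoc, le_div_iff₀ ha0]
    calc δ' * |a| ≤ δ' * δ := by gcongr
      _ ≤ K * (δ * δ') := by
        rw [mul_comm δ]
        exact le_mul_of_one_le_left (by positivity) hK
  rw [ballMoment_map_affine _ _ (abs_pos.1 ha0)]
  exact ⟨u, hu, hC _ _ _ (by positivity) hδ' hle hle', hC _ _ _ hδ' (by positivity) hle' hle⟩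

end Copies

namespace IsSelfSimilarFamily

variable {S E : Type*} [DecidableEq S] [Fintype E] {src tgt : E → S} {p : E → ℝ≥0∞}
  {c t : E → ℝ} {ν : S → Measure ℝ}

theorem exists_ratio_bounds (h : IsSelfSimilarFamily src tgt p c t ν) :
    ∃ K θ : ℝ, 1 ≤ K ∧ 0 < θ ∧ θ < 1 ∧ ∀ e, 1 ≤ K * |c e| ∧ |c e| ≤ θ := by
  obtain ⟨K, hK⟩ := Finite.exists_le fun e => |c e|⁻¹
  have hlt : ∀ᶠ θ in 𝓝[<] (1 : ℝ), ∀ e, |c e| ≤ θ := eventually_all.2 fun e =>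
    (eventually_nhdsWithin_of_eventually_nhds (lt_mem_nhds (h.ratio_lt_one e))).mono
      fun _ => le_of_lt
  obtain ⟨θ, hθ, hθ0, hθ1⟩ := (hlt.and (Ioo_mem_nhdsLT zero_lt_one)).exists
  refine ⟨max K 1, θ, le_max_right _ _, hθ0, hθ1, fun e => ⟨?_, hθ e⟩⟩
  rw [← div_le_iff₀ (abs_pos.2 (h.ratio_ne_zero e)), one_div]
  exact (hK e).trans (le_max_left _ _)

-- The relation `ν s = ∑ p_e ν_{t(e)} ∘ f_e⁻¹` is expanded along each path of the graph until the
-- ratio of the composed similarity drops to `δ`.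
theorem exists_mem_span_copies (h : IsSelfSimilarFamily src tgt p c t ν) :
    ∃ K : ℝ, 1 ≤ K ∧ ∀ δ, 0 < δ → δ ≤ 1 → ∀ s,
      ν s ∈ Submodule.span ℝ≥0∞ (copies src tgt ν K δ s) := by
  obtain ⟨K, θ, hK, hθ, hθ1, hc⟩ := h.exists_ratio_bounds
  have hbase : ∀ δ, 1 ≤ δ → δ ≤ K → ∀ s, ν s ∈ copies src tgt ν K δ s := fun δ h1 h2 s =>
    ⟨s, 1, 0, Relation.ReflTransGen.refl, by simpa, by simpa, by simp⟩
  have key : ∀ (n : ℕ) (δ : ℝ), θ ^ n ≤ δ → δ ≤ K → ∀ s,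
      ν s ∈ Submodule.span ℝ≥0∞ (copies src tgt ν K δ s) := by
    intro n
    induction n with
    | zero => exact fun δ h1 h2 s => Submodule.subset_span (hbase δ (by simpa using h1) h2 s)
    | succ n ih =>
      intro δ hδ hδK s
      rcases le_total 1 δ with h1 | h1
      · exact Submodule.subset_span (hbase δ h1 hδK s)
      rw [h.selfSimilar s]
      refine Submodule.sum_mem _ fun e he => Submodule.smul_mem _ _ ?_
      obtain rfl : src e = s := by simpa using he
      have hc0 : 0 < |c e| := abs_pos.2 (h.ratio_ne_zero e)
      refine map_affine_mem_span_copies (h.ratio_ne_zero e) _ (ih _ ?_ ?_ _)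
      · rw [le_div_iff₀ hc0]
        calc θ ^ n * |c e| ≤ θ ^ n * θ := by gcongr; exact (hc e).2
          _ ≤ δ := by rwa [← pow_succ]
      · rw [div_le_iff₀ hc0]
        exact h1.trans (hc e).1
  refine ⟨K, hK, fun δ hδ hδ1 s => ?_⟩
  obtain ⟨n, hn⟩ := exists_pow_lt_of_lt_one hδ hθ1
  exact key n δ hn.le (hδ1.trans hK) s

theorem exists_radius (h : IsSelfSimilarFamily src tgt p c t ν) :
    ∃ R : ℝ, 1 ≤ R ∧ ∀ s, ν s (closedBall 0 R)ᶜ = 0 := by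
  obtain ⟨R, hR⟩ := h.bounded
  exact ⟨max 1 R, le_max_left _ _, fun s => measure_mono_null (Set.compl_subset_compl.2
    (Metric.closedBall_subset_closedBall (le_max_right _ _))) (hR s)⟩

theorem exists_ballMoment_tgt_le (h : IsSelfSimilarFamily src tgt p c t ν) {q : ℝ} (hq : 0 ≤ q)
    (e : E) : ∃ C : ℝ≥0, ∀ r, 0 < r →
      ballMoment (ν (tgt e)) q r ≤ C * ballMoment (ν (src e)) q r := by
  have := h.isProbability
  obtain ⟨K, θ, hK, -, hθ1, hc⟩ := h.exists_ratio_bounds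
  obtain ⟨C, hC⟩ := exists_ballMoment_le_of_le_mul hq K
  have hc0 : 0 < |c e| := abs_pos.2 (h.ratio_ne_zero e)
  have hp : p e ^ q ≠ 0 := by simp [h.weight_ne_zero e, h.weight_ne_top e]
  have hp' : p e ^ q ≠ ∞ := ENNReal.rpow_ne_top_of_nonneg hq (h.weight_ne_top e)
  refine ⟨C * (p e ^ q)⁻¹.toNNReal, fun r hr => ?_⟩
  have hle : p e • (ν (tgt e)).map (fun x => c e * x + t e) ≤ ν (src e) := by
    rw [h.selfSimilar (src e)]
    exact Finset.single_le_sum (f := fun e => p e • (ν (tgt e)).map fun x => c e * x + t e)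
      (fun _ _ => Measure.zero_le _) (by simp)
  have hbm := ballMoment_mono_measure hle hq r
  rw [ballMoment_smul _ hq (h.weight_ne_zero e) (h.weight_ne_top e),
    ballMoment_map_affine _ _ (h.ratio_ne_zero e), ENNReal.mul_le_iff_le_inv hp hp'] at hbm
  rw [ENNReal.coe_mul, ENNReal.coe_toNNReal (ENNReal.inv_ne_top.2 hp), mul_assoc]
  refine (hC _ r (r / |c e|) hr (by positivity) ?_ ?_).trans (by gcongr)
  · rw [← mul_div_assoc, le_div_iff₀ hc0]
    nlinarith [(hc e).2]
  · rw [div_le_iff₀ hc0, mul_right_comm]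
    exact le_mul_of_one_le_left hr.le (hc e).1

theorem exists_ballMoment_le_of_reachable (h : IsSelfSimilarFamily src tgt p c t ν) {q : ℝ}
    (hq : 0 ≤ q) {s u : S} (hsu : Reachable src tgt s u) :
    ∃ C : ℝ≥0, ∀ r, 0 < r → ballMoment (ν u) q r ≤ C * ballMoment (ν s) q r := by
  induction hsu with
  | refl => exact ⟨1, fun r _ => by simp⟩
  | tail _ he ih =>
    obtain ⟨C, hC⟩ := ih
    obtain ⟨e, rfl, rfl⟩ := he
    obtain ⟨C', hC'⟩ := h.exists_ballMoment_tgt_le hq e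
    refine ⟨C' * C, fun r hr => (hC' r hr).trans ?_⟩
    rw [ENNReal.coe_mul, mul_assoc]
    gcongr
    exact hC r hr

variable [Finite S]

theorem exists_forall_ballMoment_le (h : IsSelfSimilarFamily src tgt p c t ν) {q : ℝ}
    (hq : 0 ≤ q) : ∃ C : ℝ≥0, ∀ s u, Reachable src tgt s u → ∀ r, 0 < r →
      ballMoment (ν u) q r ≤ C * ballMoment (ν s) q r := by
  choose C hC using fun z : {z : S × S // Reachable src tgt z.1 z.2} =>
    h.exists_ballMoment_le_of_reachable hq z.2
  obtain ⟨C', hC'⟩ := Finite.exists_le C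
  refine ⟨C', fun s u hsu r hr => (hC ⟨(s, u), hsu⟩ r hr).trans ?_⟩
  gcongr
  exact hC' _

theorem exists_ballMoment_copy_le (h : IsSelfSimilarFamily src tgt p c t ν) {q : ℝ}
    (hq : 0 ≤ q) {K : ℝ} (hK : 1 ≤ K) : ∃ C : ℝ≥0, ∀ δ δ', 0 < δ → 0 < δ' → ∀ s,
      ∀ κ ∈ copies src tgt ν K δ s, ballMoment κ q (δ * δ') ≤ C * ballMoment (ν s) q δ' := by
  obtain ⟨C₁, h₁⟩ := exists_ballMoment_copy_comparable h.isProbability hq hK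
  obtain ⟨C₂, h₂⟩ := h.exists_forall_ballMoment_le hq
  refine ⟨C₁ * C₂, fun δ δ' hδ hδ' s κ hκ => ?_⟩
  obtain ⟨u, hu, hle, -⟩ := h₁ δ δ' hδ hδ' s κ hκ
  rw [ENNReal.coe_mul, mul_assoc]
  exact hle.trans (by gcongr; exact h₂ s u hu δ' hδ')

theorem exists_ballMoment_le_copy (h : IsSelfSimilarFamily src tgt p c t ν) {q : ℝ}
    (hq : 0 ≤ q) {K : ℝ} (hK : 1 ≤ K) {s : S}
    (hs : ∀ u, Reachable src tgt s u → Reachable src tgt u s) :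
    ∃ C : ℝ≥0, ∀ δ δ', 0 < δ → 0 < δ' → ∀ κ ∈ copies src tgt ν K δ s,
      ballMoment (ν s) q δ' ≤ C * ballMoment κ q (δ * δ') := by
  obtain ⟨C₁, h₁⟩ := exists_ballMoment_copy_comparable h.isProbability hq hK
  obtain ⟨C₂, h₂⟩ := h.exists_forall_ballMoment_le hq
  refine ⟨C₂ * C₁, fun δ δ' hδ hδ' κ hκ => ?_⟩
  obtain ⟨u, hu, -, hle⟩ := h₁ δ δ' hδ hδ' s κ hκ
  rw [ENNReal.coe_mul, mul_assoc]
  exact (h₂ u s (hs u hu) δ' hδ').trans (by gcongr)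

theorem exists_ballMoment_mul_le (h : IsSelfSimilarFamily src tgt p c t ν) {q : ℝ}
    (hq : 1 ≤ q) (s : S) : ∃ C : ℝ≥0, ∀ δ δ', 0 < δ → δ ≤ 1 → 0 < δ' → δ' ≤ 1 →
      ballMoment (ν s) q (δ * δ') ≤ C * (ballMoment (ν s) q δ * ballMoment (ν s) q δ') := by
  have := h.isProbability
  have hq0 : 0 ≤ q := zero_le_one.trans hq
  obtain ⟨R, hR1, hR⟩ := h.exists_radius
  have hR0 : 0 < R := zero_lt_one.trans_le hR1
  have hRδ : ∀ δ, 0 < δ → δ ≤ R * δ := fun δ hδ => le_mul_of_one_le_left hδ.le hR1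
  obtain ⟨K, hK, hmem⟩ := h.exists_mem_span_copies
  obtain ⟨C₁, h₁⟩ := h.exists_ballMoment_copy_le hq0 hK
  obtain ⟨C₂, h₂⟩ := exists_ballMoment_le_of_le_mul hq0 (4 * R)
  refine ⟨2 * C₁ * C₂, fun δ δ' hδ hδ1 hδ' hδ'1 => ?_⟩
  calc ballMoment (ν s) q (δ * δ')
      ≤ 2 * (C₁ * ballMoment (ν s) q δ') * ballMoment (ν s) q (4 * (R * δ)) :=
        ballMoment_le_mul_ballMoment_of_mem_span
          (fun κ => isProbabilityMeasure_of_mem_copies h.isProbability) (hmem δ hδ hδ1 s)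
          (fun κ => exists_carried_of_mem_copies hR0.le hR) (by positivity) hq (by nlinarith)
          (h₁ δ δ' hδ hδ' s)
    _ ≤ 2 * (C₁ * ballMoment (ν s) q δ') * (C₂ * ballMoment (ν s) q δ) := by
        gcongr
        exact h₂ _ _ _ (by positivity) hδ (by linarith)
          (by linarith [hRδ δ hδ, hRδ (R * δ) (by positivity)])
    _ = _ := by
        push_cast
        ring

theorem exists_mul_le_ballMoment (h : IsSelfSimilarFamily src tgt p c t ν) {q : ℝ}
    (hq : 0 ≤ q) (hq1 : q ≤ 1) {s : S}
    (hs : ∀ u, Reachable src tgt s u → Reachable src tgt u s) :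
    ∃ C : ℝ≥0, ∀ δ δ', 0 < δ → δ ≤ 1 → 0 < δ' → δ' ≤ 1 →
      ballMoment (ν s) q δ * ballMoment (ν s) q δ' ≤ C * ballMoment (ν s) q (δ * δ') := by
  have := h.isProbability
  obtain ⟨R, hR1, hR⟩ := h.exists_radius
  have hR0 : 0 < R := zero_lt_one.trans_le hR1
  have hRδ : ∀ δ, 0 < δ → δ ≤ R * δ := fun δ hδ => le_mul_of_one_le_left hδ.le hR1
  obtain ⟨K, hK, hmem⟩ := h.exists_mem_span_copies
  obtain ⟨C₁, h₁⟩ := h.exists_ballMoment_le_copy hq hK hs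
  obtain ⟨C₂, h₂⟩ := exists_ballMoment_le_of_le_mul hq R
  refine ⟨C₂ * (C₁ + 1) * 8, fun δ δ' hδ hδ1 hδ' hδ'1 => ?_⟩
  have hC : (C₁ + 1 : ℝ≥0∞) ≠ 0 := by simp
  calc ballMoment (ν s) q δ * ballMoment (ν s) q δ'
      ≤ C₂ * ballMoment (ν s) q (R * δ) * ballMoment (ν s) q δ' := by
        gcongr
        exact h₂ _ _ _ hδ (by positivity)
          ((hRδ δ hδ).trans (hRδ (R * δ) (by positivity))) le_rfl
    _ = C₂ * (C₁ + 1) * (ballMoment (ν s) q δ' / (C₁ + 1) * ballMoment (ν s) q (R * δ)) := by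
        conv_lhs => rw [← ENNReal.mul_div_cancel hC (by finiteness) (b := ballMoment (ν s) q δ')]
        ring
    _ ≤ C₂ * (C₁ + 1) * (8 * ballMoment (ν s) q (δ * δ')) := by
        gcongr _ * ?_
        refine mul_ballMoment_le_ballMoment_of_mem_span
          (fun κ => isProbabilityMeasure_of_mem_copies h.isProbability) (hmem δ hδ hδ1 s)
          (fun κ => exists_carried_of_mem_copies hR0.le hR) (by positivity) hq hq1 (by nlinarith)
          fun κ hκ => ENNReal.div_le_of_le_mul' ((h₁ δ δ' hδ hδ' κ hκ).trans ?_)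
        gcongr
        exact le_self_add
    _ = _ := by
        push_cast
        ring

end IsSelfSimilarFamily

/-! ### Growth exponents of almost multiplicative functions -/

theorem tendsto_neg_log_atTop : Tendsto (fun δ : ℝ => -Real.log δ) (𝓝[>] 0) atTop :=
  tendsto_neg_atBot_atTop.comp Real.tendsto_log_nhdsGT_zero

theorem tendsto_div_of_abs_sub_le {α : Type*} {l : Filter α} {f f' g : α → ℝ} {a B : ℝ}
    (h : Tendsto (fun x => f x / g x) l (𝓝 a)) (hg : Tendsto g l atTop)
    (hB : ∀ᶠ x in l, |f' x - f x| ≤ B) : Tendsto (fun x => f' x / g x) l (𝓝 a) := by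
  have h0 : Tendsto (fun x => (f' x - f x) / g x) l (𝓝 0) := by
    refine squeeze_zero_norm' ?_ (hg.const_div_atTop B)
    filter_upwards [hB, hg.eventually_gt_atTop 0] with x hx hgx
    rw [Real.norm_eq_abs, abs_div, abs_of_pos hgx]
    gcongr
  simpa [← add_div] using h.add h0

theorem abs_log_sub_log_le {x y C : ℝ} (hx : 0 < x) (hy : 0 < y) (h : x ≤ C * y)
    (h' : y ≤ C * x) : |Real.log x - Real.log y| ≤ Real.log C := by
  have hC : 0 < C := pos_of_mul_pos_left (hx.trans_le h) hy.le
  have hlog := Real.log_le_log hx h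
  have hlog' := Real.log_le_log hy h'
  rw [Real.log_mul hC.ne' hy.ne'] at hlog
  rw [Real.log_mul hC.ne' hx.ne'] at hlog'
  exact abs_sub_le_iff.2 ⟨by linarith, by linarith⟩

section Fekete

variable {G : ℝ → ℝ} {D K : ℝ}
  (hG : ∀ x y, 0 ≤ x → 0 ≤ y → |x - y| ≤ 1 → |G x - G y| ≤ D)

include hG

theorem abs_natCast_sub_le_mul (n : ℕ) : |G n - G 0| ≤ n * D := by
  induction n with
  | zero => simp
  | succ n ih =>
    have hstep := hG (n + 1 : ℕ) n (by positivity) (by positivity) (by simp)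
    calc |G (n + 1 : ℕ) - G 0| ≤ |G (n + 1 : ℕ) - G n| + |G n - G 0| := abs_sub_le _ _ _
      _ ≤ D + n * D := add_le_add hstep ih
      _ = (n + 1 : ℕ) * D := by
        push_cast
        ring

theorem exists_tendsto_natCast_div
    (hsub : ∀ x y, 0 ≤ x → 0 ≤ y → G (x + y) ≤ G x + G y + K) :
    ∃ L, Tendsto (fun n : ℕ => (G n + K) / n) atTop (𝓝 L) := by
  have hu : Subadditive fun n : ℕ => G n + K := fun m n => by
    have := hsub m n (by positivity) (by positivity)
    push_cast
    linarith
  have hD : 0 ≤ D := (abs_nonneg _).trans (hG 0 0 le_rfl le_rfl (by simp))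
  refine ⟨hu.lim, hu.tendsto_lim ⟨-(|G 0 + K| + D), ?_⟩⟩
  rintro _ ⟨n, rfl⟩
  rcases n.eq_zero_or_pos with rfl | hn
  · simp only [Nat.cast_zero, div_zero]
    exact neg_nonpos.2 (add_nonneg (abs_nonneg _) hD)
  have hn1 : (1 : ℝ) ≤ n := by exact_mod_cast hn
  have hle : |G 0 + K| ≤ n * |G 0 + K| := le_mul_of_one_le_left (abs_nonneg _) hn1
  have hlip := (abs_le.1 (abs_natCast_sub_le_mul hG n)).1
  rw [le_div_iff₀ (by linarith)]
  linarith [neg_abs_le (G 0 + K)]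

theorem exists_tendsto_div_atTop
    (hsub : ∀ x y, 0 ≤ x → 0 ≤ y → G (x + y) ≤ G x + G y + K) :
    ∃ L, Tendsto (fun x => G x / x) atTop (𝓝 L) := by
  obtain ⟨L, hL⟩ := exists_tendsto_natCast_div hG hsub
  have hfloor : Tendsto (fun x : ℝ => (G ⌊x⌋₊ + K) / x) atTop (𝓝 L) := by
    have hprod := (hL.comp tendsto_nat_floor_atTop).mul (tendsto_nat_floor_div_atTop (R := ℝ))
    rw [mul_one] at hprod
    refine hprod.congr' ?_
    filter_upwards [eventually_ge_atTop 1] with x hx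
    have : (⌊x⌋₊ : ℝ) ≠ 0 := by exact_mod_cast (Nat.floor_pos.2 hx).ne'
    simp only [Function.comp_apply]
    field_simp
  refine ⟨L, tendsto_div_of_abs_sub_le (B := D + |K|) hfloor tendsto_id ?_⟩
  filter_upwards [eventually_ge_atTop 0] with x hx
  have hclose : |x - ⌊x⌋₊| ≤ 1 :=
    abs_le.2 ⟨by linarith [Nat.floor_le hx], by linarith [Nat.lt_floor_add_one x]⟩
  rw [← sub_sub]
  exact (abs_sub _ _).trans (add_le_add (hG x _ hx (by positivity) hclose) le_rfl)

end Fekete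

section Multiplicative

theorem tendsto_log_div_neg_log {F : ℝ → ℝ} {a : ℝ}
    (h : Tendsto (fun x => Real.log (F (Real.exp (-x))) / x) atTop (𝓝 a)) :
    Tendsto (fun δ => Real.log (F δ) / -Real.log δ) (𝓝[>] 0) (𝓝 a) := by
  refine (h.comp tendsto_neg_log_atTop).congr' ?_
  filter_upwards [self_mem_nhdsWithin] with δ hδ
  simp only [Function.comp_apply, neg_neg, Real.exp_log hδ]

variable {F : ℝ → ℝ} {C K : ℝ} (hpos : ∀ δ, 0 < δ → 0 < F δ)
  (hcomp : ∀ δ δ', 0 < δ → 0 < δ' → δ ≤ Real.exp 1 * δ' → δ' ≤ Real.exp 1 * δ → F δ ≤ C * F δ')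

include hpos hcomp

theorem abs_log_exp_neg_sub_le {x y : ℝ} (h : |x - y| ≤ 1) :
    |Real.log (F (Real.exp (-x))) - Real.log (F (Real.exp (-y)))| ≤ Real.log C := by
  obtain ⟨hxy, hyx⟩ := abs_sub_le_iff.1 h
  have hle : Real.exp (-x) ≤ Real.exp 1 * Real.exp (-y) := by
    rw [← Real.exp_add]
    gcongr
    linarith
  have hle' : Real.exp (-y) ≤ Real.exp 1 * Real.exp (-x) := by
    rw [← Real.exp_add]
    gcongr
    linarith
  exact abs_log_sub_log_le (hpos _ (Real.exp_pos _)) (hpos _ (Real.exp_pos _))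
    (hcomp _ _ (Real.exp_pos _) (Real.exp_pos _) hle hle')
    (hcomp _ _ (Real.exp_pos _) (Real.exp_pos _) hle' hle)

theorem exists_tendsto_log_div_of_submultiplicative
    (hmul : ∀ δ δ', 0 < δ → δ ≤ 1 → 0 < δ' → δ' ≤ 1 → F (δ * δ') ≤ K * (F δ * F δ')) :
    ∃ a, Tendsto (fun δ => Real.log (F δ) / -Real.log δ) (𝓝[>] 0) (𝓝 a) := by
  obtain ⟨L, hL⟩ := exists_tendsto_div_atTop (G := fun x => Real.log (F (Real.exp (-x))))
    (K := Real.log K) (fun x y _ _ h => abs_log_exp_neg_sub_le hpos hcomp h) fun x y hx hy => by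
      have hFx := hpos _ (Real.exp_pos (-x))
      have hFy := hpos _ (Real.exp_pos (-y))
      have hFxy := hpos _ (mul_pos (Real.exp_pos (-x)) (Real.exp_pos (-y)))
      have hle := hmul _ _ (Real.exp_pos (-x)) (by simpa) (Real.exp_pos (-y)) (by simpa)
      have hK : 0 < K := pos_of_mul_pos_left (hFxy.trans_le hle) (mul_pos hFx hFy).le
      have hlog := Real.log_le_log hFxy hle
      rw [Real.log_mul hK.ne' (mul_pos hFx hFy).ne', Real.log_mul hFx.ne' hFy.ne',
        ← Real.exp_add, ← neg_add] at hlog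
      linarith
  exact ⟨L, tendsto_log_div_neg_log hL⟩

theorem exists_tendsto_log_div_of_supermultiplicative
    (hmul : ∀ δ δ', 0 < δ → δ ≤ 1 → 0 < δ' → δ' ≤ 1 → F δ * F δ' ≤ K * F (δ * δ')) :
    ∃ a, Tendsto (fun δ => Real.log (F δ) / -Real.log δ) (𝓝[>] 0) (𝓝 a) := by
  have hinv : ∀ {x y c : ℝ}, 0 < x → 0 < y → y ≤ c * x → x⁻¹ ≤ c * y⁻¹ := fun hx hy h => by
    rwa [← div_eq_mul_inv, le_div_iff₀ hy, inv_mul_le_iff₀ hx, mul_comm]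
  obtain ⟨a, ha⟩ := exists_tendsto_log_div_of_submultiplicative (F := fun δ => (F δ)⁻¹)
    (fun δ hδ => inv_pos.2 (hpos δ hδ))
    (fun δ δ' hδ hδ' h h' => hinv (hpos δ hδ) (hpos δ' hδ') (hcomp δ' δ hδ' hδ h' h))
    fun δ δ' hδ hδ1 hδ' hδ'1 => by
      rw [← mul_inv]
      exact hinv (hpos _ (by positivity)) (mul_pos (hpos δ hδ) (hpos δ' hδ'))
        (hmul δ δ' hδ hδ1 hδ' hδ'1)
  refine ⟨-a, ha.neg.congr fun δ => ?_⟩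
  rw [Real.log_inv, neg_div, neg_neg]

end Multiplicative

/-! ### Existence of the spectrum -/

theorem tendsto_log_div_of_isTheta {f g : ℝ → ℝ} (hfg : f =Θ[𝓝[>] 0] g)
    (hf : ∀ᶠ δ in 𝓝[>] 0, f δ ≠ 0) {a : ℝ}
    (h : Tendsto (fun δ => Real.log (f δ) / -Real.log δ) (𝓝[>] 0) (𝓝 a)) :
    Tendsto (fun δ => Real.log (g δ) / -Real.log δ) (𝓝[>] 0) (𝓝 a) := by
  obtain ⟨C, hC⟩ := hfg.1.bound
  obtain ⟨C', hC'⟩ := hfg.2.bound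
  refine tendsto_div_of_abs_sub_le (B := Real.log (max C C')) h tendsto_neg_log_atTop ?_
  filter_upwards [hf, hC, hC', hfg.eq_zero_iff] with δ hf hC hC' hzero
  rw [← Real.log_abs (f δ), ← Real.log_abs (g δ)]
  refine abs_log_sub_log_le (abs_pos.2 (mt hzero.2 hf)) (abs_pos.2 hf) (hC'.trans ?_) (hC.trans ?_)
  · exact mul_le_mul_of_nonneg_right (le_max_right _ _) (abs_nonneg _)
  · exact mul_le_mul_of_nonneg_right (le_max_left _ _) (abs_nonneg _)

theorem hasLqSpectrum_of_tendsto {ν : Measure ℝ} {q τ : ℝ}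
    (h : Tendsto (fun δ => Real.log (meshSum ν q δ) / -Real.log δ) (𝓝[>] 0) (𝓝 τ)) :
    HasLqSpectrum ν q τ := by
  have h' : Tendsto (fun δ => ((Real.log (meshSum ν q δ) / -Real.log δ : ℝ) : EReal)) (𝓝[>] 0)
      (𝓝 (τ : EReal)) := (continuous_coe_real_ereal.tendsto τ).comp h
  exact ⟨h'.liminf_eq, h'.limsup_eq⟩

namespace IsSelfSimilarFamily

variable {S E : Type*} [DecidableEq S] [Fintype E] {src tgt : E → S} {p : E → ℝ≥0∞}
  {c t : E → ℝ} {ν : S → Measure ℝ}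

theorem ballMoment_ne_top (h : IsSelfSimilarFamily src tgt p c t ν) {q : ℝ} (hq : 0 ≤ q) (s : S)
    (δ : ℝ) : ballMoment (ν s) q δ ≠ ∞ := by
  have := h.isProbability
  obtain ⟨R, hR⟩ := h.bounded
  exact BoxLike.ballMoment_ne_top hq (hR s) δ

theorem toReal_ballMoment_pos (h : IsSelfSimilarFamily src tgt p c t ν) {q : ℝ} (hq : 0 ≤ q)
    (s : S) {δ : ℝ} (hδ : 0 < δ) : 0 < (ballMoment (ν s) q δ).toReal := by
  have := h.isProbability
  exact ENNReal.toReal_pos (ballMoment_ne_zero (ν s) hq hδ) (h.ballMoment_ne_top hq s δ)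

variable [Finite S] {s : S}

theorem exists_tendsto_log_ballMoment_div (h : IsSelfSimilarFamily src tgt p c t ν) {q : ℝ}
    (hq : 0 ≤ q) (hs : ∀ u, Reachable src tgt s u → Reachable src tgt u s) :
    ∃ τ, Tendsto (fun δ => Real.log (ballMoment (ν s) q δ).toReal / -Real.log δ) (𝓝[>] 0)
      (𝓝 τ) := by
  have := h.isProbability
  have hpos := fun δ => h.toReal_ballMoment_pos hq s (δ := δ)
  have htop := h.ballMoment_ne_top hq s
  obtain ⟨C, hC⟩ := exists_ballMoment_le_of_le_mul hq (Real.exp 1)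
  have hcomp := fun δ δ' hδ hδ' hle hle' =>
    toReal_le_mul_toReal (hC (ν s) δ δ' hδ hδ' hle hle') (htop δ')
  rcases le_total 1 q with hq1 | hq1
  · obtain ⟨K, hK⟩ := h.exists_ballMoment_mul_le hq1 s
    refine exists_tendsto_log_div_of_submultiplicative hpos hcomp (K := K)
      fun δ δ' hδ hδ1 hδ' hδ'1 => ?_
    rw [← ENNReal.toReal_mul]
    exact toReal_le_mul_toReal (hK δ δ' hδ hδ1 hδ' hδ'1) (ENNReal.mul_ne_top (htop δ) (htop δ'))
  · obtain ⟨K, hK⟩ := h.exists_mul_le_ballMoment hq hq1 hs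
    refine exists_tendsto_log_div_of_supermultiplicative hpos hcomp (K := K)
      fun δ δ' hδ hδ1 hδ' hδ'1 => ?_
    rw [← ENNReal.toReal_mul]
    exact toReal_le_mul_toReal (hK δ δ' hδ hδ1 hδ' hδ'1) (htop _)

theorem isTheta_ballMoment (h : IsSelfSimilarFamily src tgt p c t ν) {q : ℝ} (hq : 0 ≤ q) {u : S}
    (hsu : Reachable src tgt s u) (hus : Reachable src tgt u s) :
    (fun δ => (ballMoment (ν s) q δ).toReal) =Θ[𝓝[>] 0]
      fun δ => (ballMoment (ν u) q δ).toReal := by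
  obtain ⟨C, hC⟩ := h.exists_forall_ballMoment_le hq
  exact ⟨isBigO_toReal (eventually_mem_nhdsWithin.mono (hC u s hus))
      (Eventually.of_forall (h.ballMoment_ne_top hq u)),
    isBigO_toReal (eventually_mem_nhdsWithin.mono (hC s u hsu))
      (Eventually.of_forall (h.ballMoment_ne_top hq s))⟩

theorem exists_hasLqSpectrum (h : IsSelfSimilarFamily src tgt p c t ν) {q : ℝ} (hq : 0 ≤ q)
    (hs : ∀ u, Reachable src tgt s u → Reachable src tgt u s) :
    ∃ τ : ℝ, ∀ u, Reachable src tgt s u → HasLqSpectrum (ν u) q τ := by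
  have := h.isProbability
  obtain ⟨R, hR⟩ := h.bounded
  obtain ⟨τ, hτ⟩ := h.exists_tendsto_log_ballMoment_div hq hs
  refine ⟨τ, fun u hu => hasLqSpectrum_of_tendsto ?_⟩
  have hmesh := (h.isTheta_ballMoment hq hu (hs u hu)).trans
    (isTheta_toReal_ballMoment_meshSum hq (hR u))
  exact tendsto_log_div_of_isTheta hmesh
    (eventually_mem_nhdsWithin.mono fun δ hδ => (h.toReal_ballMoment_pos hq s hδ).ne') hτ

end IsSelfSimilarFamily

/-! ### The graph of coordinate axes -/

namespace GIFS

variable {V E : Type*}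

open Classical in
/-- The coordinate of the argument on which the coordinate `i` of the value of `ψ e` depends. -/
def axis (G : GIFS V E) (e : E) (i : Fin 2) : Fin 2 :=
  if IsContractingDiagonal (G.T e) then i else i.rev

theorem axis_rev (G : GIFS V E) (e : E) (i : Fin 2) : G.axis e i.rev = (G.axis e i).rev := by
  unfold axis
  split_ifs <;> rfl

/-- The entry of the `i`-th row of `T e` off which that row vanishes. -/
def ratio (G : GIFS V E) (e : E) (i : Fin 2) : ℝ := G.T e i (G.axis e i)

theorem ψ_apply (G : GIFS V E) (e : E) (ξ : Fin 2 → ℝ) (i : Fin 2) :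
    G.ψ e ξ i = G.ratio e i * ξ (G.axis e i) + G.t e i := by
  unfold ratio axis ψ
  split_ifs with h
  · obtain ⟨a, b, -, -, hT⟩ := h
    rw [hT]
    fin_cases i <;> simp [dotProduct, Fin.sum_univ_two]
  · obtain ⟨a, b, -, -, hT⟩ := (G.boxLike e).resolve_left h
    rw [hT]
    fin_cases i <;> simp [dotProduct, Fin.sum_univ_two]

theorem abs_ratio_pos_and_lt_one (G : GIFS V E) (e : E) (i : Fin 2) :
    0 < |G.ratio e i| ∧ |G.ratio e i| < 1 := by
  unfold ratio axis
  split_ifs with h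
  · obtain ⟨a, b, ha, hb, hT⟩ := h
    rw [hT]
    fin_cases i
    exacts [ha, hb]
  · obtain ⟨a, b, ha, hb, hT⟩ := (G.boxLike e).resolve_left h
    rw [hT]
    fin_cases i
    exacts [ha, hb]

/-- The initial vertex of an edge of the double cover of the graph. Its vertices are the pairs of a
vertex and a coordinate axis; over each edge `e` lie the two edges `(e, i)` from `(src e, i)` to
`(tgt e, axis e i)`, since the `i`-th projection of `μ_{t(e)} ∘ ψ_e⁻¹` is a similar copy of the
`axis e i`-th projection of `μ_{t(e)}`. -/
def coverSrc (G : GIFS V E) (z : E × Fin 2) : V × Fin 2 := (G.src z.1, z.2)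

/-- The terminal vertex of an edge of the double cover of the graph. -/
def coverTgt (G : GIFS V E) (z : E × Fin 2) : V × Fin 2 := (G.tgt z.1, G.axis z.1 z.2)

/-- Reachability in the double cover of the graph. -/
def CoverReachable (G : GIFS V E) : V × Fin 2 → V × Fin 2 → Prop :=
  Reachable G.coverSrc G.coverTgt

variable {G : GIFS V E}

theorem CoverReachable.trans {m m' m'' : V × Fin 2} (h : G.CoverReachable m m')
    (h' : G.CoverReachable m' m'') : G.CoverReachable m m'' :=
  Relation.ReflTransGen.trans h h'

theorem CoverReachable.rev {m m' : V × Fin 2} (h : G.CoverReachable m m') :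
    G.CoverReachable (m.1, m.2.rev) (m'.1, m'.2.rev) := by
  refine Relation.ReflTransGen.lift (fun m : V × Fin 2 => (m.1, m.2.rev)) ?_ _ _ h
  rintro _ _ ⟨⟨e, i⟩, rfl, rfl⟩
  exact ⟨(e, i.rev), rfl, by simp only [coverTgt, axis_rev]⟩

theorem coverReachable_edge (e : E) (i : Fin 2) :
    G.CoverReachable (G.src e, i) (G.tgt e, G.axis e i) :=
  .single ⟨(e, i), rfl, rfl⟩

namespace StronglyConnected

variable (hG : G.StronglyConnected)
include hG

theorem exists_coverReachable (v v' : V) (i : Fin 2) : ∃ i', G.CoverReachable (v, i) (v', i') := by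
  induction hG v v' with
  | single h =>
    obtain ⟨e, rfl, rfl⟩ := h
    exact ⟨_, coverReachable_edge e i⟩
  | tail _ h ih =>
    obtain ⟨e, rfl, rfl⟩ := h
    obtain ⟨j, hj⟩ := ih
    exact ⟨_, hj.trans (coverReachable_edge e j)⟩

theorem coverReachable_of_diagonal (hT : ∀ e, IsContractingDiagonal (G.T e)) (v v' : V)
    (i : Fin 2) : G.CoverReachable (v, i) (v', i) := by
  have hedge : ∀ e, G.CoverReachable (G.src e, i) (G.tgt e, i) := fun e => by
    simpa only [axis, hT e, if_true] using coverReachable_edge (G := G) e i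
  induction hG v v' with
  | single h =>
    obtain ⟨e, rfl, rfl⟩ := h
    exact hedge e
  | tail _ h ih =>
    obtain ⟨e, rfl, rfl⟩ := h
    exact ih.trans (hedge e)

-- A path from `m'` back to the vertex of `m` ends at `m` or at its reverse `m.rev`; in the second
-- case the path `m → m' → m.rev` has the reverse `m.rev → m`.
theorem coverReachable_symm {m m' : V × Fin 2} (h : G.CoverReachable m m') :
    G.CoverReachable m' m := by
  obtain ⟨j, hj⟩ : ∃ j, G.CoverReachable m' (m.1, j) := hG.exists_coverReachable m'.1 m.1 m'.2
  have hcases : ∀ i j : Fin 2, j = i ∨ j = i.rev := by decide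
  rcases hcases m.2 j with rfl | rfl
  · exact hj
  · have hrev := (h.trans hj).rev
    rw [Fin.rev_rev] at hrev
    exact hj.trans hrev

theorem exists_section : ∃ σ : V → Fin 2, ∀ v v', G.CoverReachable (v, σ v) (v', σ v') := by
  rcases isEmpty_or_nonempty V with hV | ⟨⟨v₀⟩⟩
  · exact ⟨fun _ => 0, hV.elim⟩
  choose σ hσ using fun v => hG.exists_coverReachable v₀ v 0
  exact ⟨σ, fun v v' => (hG.coverReachable_symm (hσ v)).trans (hσ v')⟩

end StronglyConnected

namespace IsMeasureFamily

variable [DecidableEq V] [Fintype E] {p : E → ℝ} {μ : V → Measure (Fin 2 → ℝ)}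

theorem proj_eq_sum (hμ : G.IsMeasureFamily p μ) (v : V) (i : Fin 2) :
    proj (μ v) i = ∑ e with G.src e = v, ENNReal.ofReal (p e) •
      (proj (μ (G.tgt e)) (G.axis e i)).map fun x => G.ratio e i * x + G.t e i := by
  have hψ : ∀ e, Measurable (G.ψ e) := fun e => measurable_pi_lambda _ fun j => by
    simp only [ψ_apply]
    fun_prop
  unfold proj
  conv_lhs => rw [hμ.selfAffine v]
  rw [Measure.map_finset_sum (measurable_pi_apply i).aemeasurable]
  refine Finset.sum_congr rfl fun e _ => ?_
  rw [Measure.map_smul, Measure.map_map (by fun_prop) (hψ e),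
    Measure.map_map (by fun_prop) (by fun_prop)]
  congr 2
  funext ξ
  exact G.ψ_apply e ξ i

theorem exists_proj_compl_closedBall_eq_zero [Finite V] (hμ : G.IsMeasureFamily p μ) :
    ∃ R : ℝ, ∀ v i, proj (μ v) i (closedBall 0 R)ᶜ = 0 := by
  obtain ⟨X, hX, hsupp⟩ := hμ.supported
  obtain ⟨R, hR⟩ :=
    (Bornology.isBounded_iUnion.2 fun v => (hX v).2.1.isBounded).subset_closedBall 0
  refine ⟨R, fun v i => ?_⟩
  rw [proj, Measure.map_apply (by fun_prop) Metric.isClosed_closedBall.measurableSet.compl]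
  refine measure_mono_null (t := (X v)ᶜ) (fun ξ hξ hξX => hξ ?_) (hsupp v)
  have hnorm := hR (Set.mem_iUnion.2 ⟨v, hξX⟩)
  rw [mem_closedBall_zero_iff] at hnorm ⊢
  exact (norm_le_pi_norm ξ i).trans hnorm

theorem isSelfSimilarFamily [Finite V] (hp : G.IsPositiveVector p) (hμ : G.IsMeasureFamily p μ) :
    IsSelfSimilarFamily G.coverSrc G.coverTgt (fun z => ENNReal.ofReal (p z.1))
      (fun z => G.ratio z.1 z.2) (fun z => G.t z.1 z.2) (fun m => proj (μ m.1) m.2) where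
  isProbability m := by
    have := hμ.isProbability m.1
    exact Measure.isProbabilityMeasure_map (measurable_pi_apply m.2).aemeasurable
  bounded := hμ.exists_proj_compl_closedBall_eq_zero.imp fun _ hR m => hR m.1 m.2
  weight_ne_zero z := by simpa using hp.1 z.1
  weight_ne_top _ := ENNReal.ofReal_ne_top
  ratio_ne_zero z := abs_pos.1 (G.abs_ratio_pos_and_lt_one z.1 z.2).1
  ratio_lt_one z := (G.abs_ratio_pos_and_lt_one z.1 z.2).2
  selfSimilar := by
    rintro ⟨v, i⟩
    rw [hμ.proj_eq_sum v i]
    exact Finset.sum_bij' (fun e _ => (e, i)) (fun z _ => z.1) (by simp [coverSrc])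
      (by simp [coverSrc]) (by simp) (by simp [coverSrc]) (by simp [coverTgt])

theorem exists_hasLqSpectrum [Finite V] (hG : G.StronglyConnected) (hp : G.IsPositiveVector p)
    (hμ : G.IsMeasureFamily p μ) {q : ℝ} (hq : 0 ≤ q) (m : V × Fin 2) :
    ∃ τ : ℝ, ∀ m', G.CoverReachable m m' → HasLqSpectrum (proj (μ m'.1) m'.2) q τ :=
  (hμ.isSelfSimilarFamily hp).exists_hasLqSpectrum hq fun _ h => hG.coverReachable_symm h

end IsMeasureFamily

end GIFS

/-! ### Splittings -/

theorem ncard_setOf_snd_eq {α β : Type*} (f : α → β) :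
    {m : α × β | m.2 = f m.1}.ncard = Nat.card α :=
  Nat.card_congr
    { toFun m := m.1.1
      invFun a := ⟨(a, f a), rfl⟩
      left_inv := fun ⟨_, hm⟩ => Subtype.ext (Prod.ext rfl hm.symm)
      right_inv _ := rfl }

theorem isSpectralSplitting_of_section {V : Type*} {μ : V → Measure (Fin 2 → ℝ)} (σ : V → Fin 2)
    (h : ∀ q : ℝ, 0 ≤ q → ∃ τ : ℝ, ∀ v, HasLqSpectrum (proj (μ v) (σ v)) q τ)
    (hrev : ∀ q : ℝ, 0 ≤ q → ∃ τ : ℝ, ∀ v, HasLqSpectrum (proj (μ v) (σ v).rev) q τ) :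
    IsSpectralSplitting μ {m | m.2 = σ m.1} {m | m.2 = (σ m.1).rev} := by
  have hcover : ∀ i j : Fin 2, j = i ∨ j = i.rev := by decide
  have hdisj : ∀ i j : Fin 2, j = i → j ≠ i.rev := by decide
  have hsep : ∀ i : Fin 2, (0 = i ∧ 1 = i.rev) ∨ (0 = i.rev ∧ 1 = i) := by decide
  refine ⟨Set.eq_univ_of_forall fun m => hcover _ _, Set.disjoint_left.2 fun m => hdisj _ _,
    ncard_setOf_snd_eq σ, ncard_setOf_snd_eq fun v => (σ v).rev, fun q hq => ?_,
    fun v => hsep (σ v)⟩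
  obtain ⟨τ, hτ⟩ := h q hq
  obtain ⟨τ', hτ'⟩ := hrev q hq
  refine ⟨τ, τ', ?_, ?_⟩
  · rintro ⟨v, _⟩ hm
    obtain rfl : _ = σ v := hm
    exact hτ v
  · rintro ⟨v, _⟩ hm
    obtain rfl : _ = (σ v).rev := hm
    exact hτ' v

theorem GIFS.IsMeasureFamily.isSpectralSplitting {V E : Type*} [Finite V] [DecidableEq V]
    [Fintype E] {G : GIFS V E} (hG : G.StronglyConnected) {p : E → ℝ} (hp : G.IsPositiveVector p)
    {μ : V → Measure (Fin 2 → ℝ)} (hμ : G.IsMeasureFamily p μ) {σ : V → Fin 2}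
    (hσ : ∀ v v', G.CoverReachable (v, σ v) (v', σ v')) :
    IsSpectralSplitting μ {m | m.2 = σ m.1} {m | m.2 = (σ m.1).rev} := by
  have hcommon : ∀ ρ : V → Fin 2, (∀ v v', G.CoverReachable (v, ρ v) (v', ρ v')) →
      ∀ q : ℝ, 0 ≤ q → ∃ τ : ℝ, ∀ v, HasLqSpectrum (proj (μ v) (ρ v)) q τ := by
    intro ρ hρ q hq
    rcases isEmpty_or_nonempty V with hV | ⟨⟨v₀⟩⟩
    · exact ⟨0, hV.elim⟩
    obtain ⟨τ, hτ⟩ := hμ.exists_hasLqSpectrum hG hp hq (v₀, ρ v₀)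
    exact ⟨τ, fun v => hτ (v, ρ v) (hρ v₀ v)⟩
  exact isSpectralSplitting_of_section σ (hcommon σ hσ)
    (hcommon (fun v => (σ v).rev) fun v v' => (hσ v v').rev)

end BoxLike

end

theorem proposition2p1 {V E : Type*} [Fintype V] [DecidableEq V] [Fintype E]
    (G : BoxLike.GIFS V E) (hG : G.StronglyConnected)
    (p : E → ℝ) (hp : G.IsPositiveVector p)
    (μ : V → MeasureTheory.Measure (Fin 2 → ℝ)) (hμ : G.IsMeasureFamily p μ) :
    (∀ q : ℝ, 0 ≤ q → ∀ v : V,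
      (∃ τ : ℝ, BoxLike.HasLqSpectrum (BoxLike.proj (μ v) 0) q τ) ∧
      (∃ τ : ℝ, BoxLike.HasLqSpectrum (BoxLike.proj (μ v) 1) q τ)) ∧
    (∃ A B : Set (V × Fin 2), BoxLike.IsSpectralSplitting μ A B) ∧
    ((∀ e, BoxLike.IsContractingDiagonal (G.T e)) →
      BoxLike.IsSpectralSplitting μ {m | m.2 = 0} {m | m.2 = 1}) := by
  have hspec : ∀ q : ℝ, 0 ≤ q → ∀ m : V × Fin 2,
      ∃ τ : ℝ, BoxLike.HasLqSpectrum (BoxLike.proj (μ m.1) m.2) q τ := fun q hq m =>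
    (hμ.exists_hasLqSpectrum hG hp hq m).imp fun _ hτ => hτ m .refl
  obtain ⟨σ, hσ⟩ := hG.exists_section
  exact ⟨fun q hq v => ⟨hspec q hq (v, 0), hspec q hq (v, 1)⟩,
    ⟨_, _, hμ.isSpectralSplitting hG hp hσ⟩,
    fun hT => hμ.isSpectralSplitting hG hp (σ := fun _ => 0) fun v v' =>
      hG.coverReachable_of_diagonal hT v v' 0⟩
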